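/- A weight function is a non-decreasing, continuous, unbounded function $w:[0,1)\to(0,+\infty)$; it is called log-convex if $\log w(r)$ is a convex function of $\log r$ for $0<r<1$. For functions $u,v$ on $[0,1)$ write $u\asymp v$ (and say that $u$ and $v$ are equivalent) if there are constants $C_1,C_2>0$ with $C_1u(r)\le v(r)\le C_2u(r)$ for all $0\le r<1$. Let $d\ge 2$ and $m\ge 1$ be integers, let $h(B_d)$ be the space of real-valued harmonic functions on the open unit ball of $\mathbb R^d$, and let $\mathcal Hol(B_m)$ be the space of holomorphic functions on the open unit ball of $\mathbb C^m$. For $f$ in either space put $$M_2(f,r)=\Big(\int_{S}|f(ry)|^2\,d\sigma(y)\Big)^{1/2},\qquad 0\le r<1,$$ where $S$ is the unit sphere of $\mathbb R^d$, respectively of $\mathbb C^m$, and $\sigma$ is the normalized Lebesgue measure on $S$. Let $w$ be a weight function. Then the following properties are equivalent: 1. $w$ is equivalent to a log-convex weight function; 2. $w$ is harmonically $L^2$-approximable, that is, there exist $J\in\mathbb N$ and $f_1,\dots,f_J\in h(B_d)$ such that $M_2^2(f_1,r)+\dots+M_2^2(f_J,r)\asymp w^2(r)$, $0\le r<1$;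 3. there exists $f\in h(B_d)$ such that $M_2(f,r)\asymp w(r)$, $0\le r<1$; 4. $w$ is holomorphically $L^2$-approximable, that is, there exist $J\in\mathbb N$ and $f_1,\dots,f_J\in\mathcal Hol(B_m)$ such that $M_2^2(f_1,r)+\dots+M_2^2(f_J,r)\asymp w^2(r)$, $0\le r<1$; 5. there exists $f\in\mathcal Hol(B_m)$ such that $M_2(f,r)\asymp w(r)$, $0\le r<1$. -/

import Mathlib

open Set MeasureTheory

/-- `w`, restricted to `[0, 1)`, is a weight function: positive, non-decreasing, continuous and
unbounded. The values of `w` outside `[0, 1)` play no role. -/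
structure IsWeightFunction (w : ℝ → ℝ) : Prop where
  pos : ∀ r ∈ Ico (0 : ℝ) 1, 0 < w r
  monotoneOn : MonotoneOn w (Ico 0 1)
  continuousOn : ContinuousOn w (Ico 0 1)
  unbounded : ¬ BddAbove (w '' Ico 0 1)

/-- `u ≍ v` on `[0, 1)`: `C₁ u ≤ v ≤ C₂ u` there, for some constants `C₁, C₂ > 0`. -/
def EquivOnUnitInterval (u v : ℝ → ℝ) : Prop :=
  ∃ C₁ C₂ : ℝ, 0 < C₁ ∧ 0 < C₂ ∧
    ∀ r ∈ Ico (0 : ℝ) 1, C₁ * u r ≤ v r ∧ v r ≤ C₂ * u r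

/-- `log w(r)` is a convex function of `t = log r`, for `0 < r < 1`, that is, `t < 0`. -/
def IsLogConvex (w : ℝ → ℝ) : Prop :=
  ConvexOn ℝ (Iio 0) fun t : ℝ => Real.log (w (Real.exp t))

/-- `M₂(f, r)`, the square root of the mean of `|f (r y)|²` over `y` in the unit sphere of `E`
with respect to the normalized Lebesgue (surface) measure. -/
noncomputable def L2Mean {E F : Type*} [NormedAddCommGroup E] [InnerProductSpace ℝ E]
    [FiniteDimensional ℝ E] [MeasurableSpace E] [BorelSpace E] [NormedAddCommGroup F]
    (f : E → F) (r : ℝ) : ℝ :=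
  Real.sqrt (⨍ y : Metric.sphere (0 : E) 1, ‖f (r • (y : E))‖ ^ 2 ∂(volume : Measure E).toSphere)

/-- `f` is a real-valued harmonic function on the open unit ball of `ℝ^d`. -/
def IsHarmonicOnBall (d : ℕ) (f : EuclideanSpace ℝ (Fin d) → ℝ) : Prop :=
  InnerProductSpace.HarmonicOnNhd f (Metric.ball 0 1)

/-- `f` is a holomorphic function on the open unit ball of `ℂ^m`. -/
def IsHolomorphicOnBall (m : ℕ) (f : EuclideanSpace ℂ (Fin m) → ℂ) : Prop :=
  DifferentiableOn ℂ f (Metric.ball 0 1)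

/-- Harmonic `L²`-approximability in dimension `d`:
`M₂²(f₁, r) + ⋯ + M₂²(f_J, r) ≍ w²(r)` for finitely many harmonic functions. -/
def IsHarmonicallyL2Approximable (d : ℕ) (w : ℝ → ℝ) : Prop :=
  ∃ (J : ℕ) (f : Fin J → EuclideanSpace ℝ (Fin d) → ℝ), (∀ j, IsHarmonicOnBall d (f j)) ∧
    EquivOnUnitInterval (fun r => ∑ j, L2Mean (f j) r ^ 2) (fun r => w r ^ 2)

/-- Holomorphic `L²`-approximability in complex dimension `m`:
`M₂²(f₁, r) + ⋯ + M₂²(f_J, r) ≍ w²(r)` for finitely many holomorphic functions. -/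
def IsHolomorphicallyL2Approximable (m : ℕ) (w : ℝ → ℝ) : Prop :=
  ∃ (J : ℕ) (f : Fin J → EuclideanSpace ℂ (Fin m) → ℂ), (∀ j, IsHolomorphicOnBall m (f j)) ∧
    EquivOnUnitInterval (fun r => ∑ j, L2Mean (f j) r ^ 2) (fun r => w r ^ 2)

/-! Approximable implies log-convex: for `f` harmonic or holomorphic, the real pairing of `f(s y)`
with `f(u y)` over the sphere depends only on the product `s u` (`integral_sphere_mul_of_harmonic`,
`integral_sphere_inner_of_holomorphic`). Hence it equals `∫ |f(√(su) y)|²`, and Cauchy–Schwarz makes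
`log M₂²` midpoint convex in `log r`. A second Cauchy–Schwarz, over the finite index, carries this
over to sums of squares; continuity upgrades midpoint convexity to convexity
(`exists_logConvex_weight_of_integral_inner`). The invariance is proved without expansions: by
Green's identity in the harmonic case, and by Cauchy's theorem on an annulus, applied on complex
lines through the origin, in the holomorphic case.

Log-convex implies approximable: below the convex graph of `log v(e^t)` one places a sequence of
lines so that at each point one line is within a constant of the graph and the others drop away
linearly in their distance along the sequence. Rounding the slopes to integers and exponentiating
gives a power series `∑ B_i r^{n_i}` whose sum and whose largest term are both comparable to `v`
(`exists_lacunary_series`), so `∑ (B_i r^{n_i})²` is comparable to `v²`. A holomorphic `F` on the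
disc is then composed with a linear map `π` to `ℂ` that turns suitable isometries into rotations.
Distinct powers of `π` are orthogonal on the sphere, and after normalising the coefficients the mean
square of `F ∘ π` is that sum, up to a constant (`exists_holomorphic_with_square_integral`). Taking
`π` to be a complex coordinate gives a holomorphic function; taking a real plane projection and the
real part gives a harmonic one. -/

/-! ### Convexity and monotonicity from a multiplicative midpoint inequality. -/

theorem convexOn_of_midpoint_le {s : Set ℝ} (hs : Convex ℝ s) {φ : ℝ → ℝ}
    (hc : ContinuousOn φ s) (hm : ∀ x ∈ s, ∀ y ∈ s, φ ((x + y) / 2) ≤ (φ x + φ y) / 2) :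
    ConvexOn ℝ s φ := by
  refine convexOn_of_slope_mono_adjacent hs ?_
  intro a b e ha he hab hbe
  have hsub : Icc a e ⊆ s := hs.ordConnected.out ha he
  have hae : a < e := hab.trans hbe
  set k := (φ e - φ a) / (e - a) with hk
  have hk' : k * (e - a) = φ e - φ a := div_mul_cancel₀ _ (sub_ne_zero.2 hae.ne')
  set δ : ℝ → ℝ := fun x => φ x - (φ a + k * (x - a)) with hδ
  have hδc : ContinuousOn δ (Icc a e) :=
    (hc.mono hsub).sub (by fun_prop)
  have key : δ b ≤ 0 := by
    by_contra! hpos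
    obtain ⟨M, hM, hMmax⟩ := isCompact_Icc.exists_isMaxOn ⟨a, left_mem_Icc.2 hae.le⟩ hδc
    have hMpos : 0 < δ M := hpos.trans_le (hMmax ⟨hab.le, hbe.le⟩)
    -- The leftmost maximum point `c` of `φ` minus its chord is interior, and just as far to its
    -- left as to its right the values are strictly lower, respectively no higher, against the
    -- midpoint inequality.
    set T := Icc a e ∩ δ ⁻¹' {δ M} with hT
    have hTc : IsCompact T :=
      isCompact_Icc.of_isClosed_subset
        (hδc.preimage_isClosed_of_isClosed isClosed_Icc isClosed_singleton) inter_subset_left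
    obtain ⟨c, hcT, hcmin⟩ := hTc.exists_isLeast ⟨M, hM, rfl⟩
    have hcδ : δ c = δ M := hcT.2
    have hca : a < c := by
      refine lt_of_le_of_ne hcT.1.1 fun h => ?_
      rw [← hcδ, ← h] at hMpos
      simp [hδ] at hMpos
    have hce : c < e := by
      refine lt_of_le_of_ne hcT.1.2 fun h => ?_
      rw [← hcδ, h] at hMpos
      simp [hδ, hk'] at hMpos
    set η := min (c - a) (e - c)
    have hη : 0 < η := lt_min (sub_pos.2 hca) (sub_pos.2 hce)
    have h1 : c - η ∈ Icc a e := ⟨by linarith [min_le_left (c - a) (e - c)], by linarith⟩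
    have h2 : c + η ∈ Icc a e := ⟨by linarith, by linarith [min_le_right (c - a) (e - c)]⟩
    have h3 : δ (c - η) < δ M := by
      refine lt_of_le_of_ne (hMmax h1) fun h => ?_
      linarith [hcmin ⟨h1, h⟩]
    have h4 : δ (c + η) ≤ δ M := hMmax h2
    have h5 := hm _ (hsub h1) _ (hsub h2)
    rw [show (c - η + (c + η)) / 2 = c by ring] at h5
    have h6 : δ c ≤ (δ (c - η) + δ (c + η)) / 2 := by simp only [hδ]; linarith
    linarith
  have h7 : φ b ≤ φ a + k * (b - a) := by simpa [hδ] using key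
  have hba : 0 < b - a := sub_pos.2 hab
  have heb : 0 < e - b := sub_pos.2 hbe
  calc (φ b - φ a) / (b - a) ≤ k := by rw [div_le_iff₀ hba]; linarith
    _ ≤ (φ e - φ b) / (e - b) := by rw [le_div_iff₀ heb]; linarith

/-- A descent of slope `-k` forces slopes at most `-k` everywhere further left, so `φ` would exceed
any bound towards `-∞`. -/
theorem ConvexOn.monotoneOn_of_bddAbove_Iio {φ : ℝ → ℝ} {a : ℝ} (h : ConvexOn ℝ (Iio a) φ)
    {B b₀ : ℝ} (hb : ∀ t < b₀, φ t ≤ B) : MonotoneOn φ (Iio a) := by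
  intro x hx y hy hxy
  by_contra! hlt
  have hxy' : x < y := lt_of_le_of_ne hxy fun h => by simp [h] at hlt
  set k := (φ x - φ y) / (y - x)
  have hk : 0 < k := div_pos (sub_pos.2 hlt) (sub_pos.2 hxy')
  set t := min (b₀ - 1) (x - (|B - φ x| + 1) / k)
  have ht1 : t < b₀ := (min_le_left _ _).trans_lt (by linarith)
  have ht2 : t ≤ x - (|B - φ x| + 1) / k := min_le_right _ _
  have hpos : 0 < (|B - φ x| + 1) / k := by positivity
  have htx : t < x := by linarith
  have := h.slope_mono_adjacent (x := t) (y := x) (z := y) (htx.trans hx) hy htx hxy'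
  have h2 : (φ y - φ x) / (y - x) = -k := by rw [← neg_div, neg_sub]
  rw [h2, div_le_iff₀ (sub_pos.2 htx)] at this
  have h3 : |B - φ x| + 1 ≤ k * (x - t) := by
    rw [← div_le_iff₀' hk]; linarith
  have := hb t ht1
  linarith [le_abs_self (B - φ x)]

/-- With `r = e^t` the hypothesis is midpoint convexity of `log g`. Continuity at `0` bounds `log g`
near `t = -∞`, which yields monotonicity; the endpoint `0` is then reached by a limit. -/
theorem monotoneOn_and_isLogConvex_of_sq_le_mul {g : ℝ → ℝ} (hc : ContinuousOn g (Ico 0 1))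
    (hpos : ∀ r ∈ Ico (0 : ℝ) 1, 0 < g r)
    (hg : ∀ s ∈ Ioo (0 : ℝ) 1, ∀ u ∈ Ioo (0 : ℝ) 1, g (√(s * u)) ^ 2 ≤ g s * g u) :
    MonotoneOn g (Ico 0 1) ∧ IsLogConvex g := by
  have hexp : ∀ t ∈ Iio (0 : ℝ), Real.exp t ∈ Ioo (0 : ℝ) 1 := fun t ht =>
    ⟨Real.exp_pos t, Real.exp_lt_one_iff.2 ht⟩
  have hexp' : ∀ t ∈ Iio (0 : ℝ), Real.exp t ∈ Ico (0 : ℝ) 1 := fun t ht =>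
    Ioo_subset_Ico_self (hexp t ht)
  have hconv : IsLogConvex g := by
    refine convexOn_of_midpoint_le (convex_Iio 0) ?_ ?_
    · exact ContinuousOn.log (hc.comp Real.continuous_exp.continuousOn hexp')
        fun t ht => (hpos _ (hexp' t ht)).ne'
    · intro x hx y hy
      have h := hg _ (hexp x hx) _ (hexp y hy)
      have he : √(Real.exp x * Real.exp y) = Real.exp ((x + y) / 2) := by
        rw [← Real.exp_add, Real.exp_half]
      rw [he] at h
      have hm : (x + y) / 2 ∈ Iio (0 : ℝ) := by simp only [mem_Iio] at *; linarith
      have h' := Real.log_le_log (pow_pos (hpos _ (hexp' _ hm)) 2) h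
      rw [Real.log_pow, Real.log_mul (hpos _ (hexp' _ hx)).ne' (hpos _ (hexp' _ hy)).ne'] at h'
      push_cast at h'
      linarith
  refine ⟨?_, hconv⟩
  have h0 : (0 : ℝ) ∈ Ico (0 : ℝ) 1 := by simp
  have hcw : ContinuousWithinAt g (Ioo 0 1) 0 := (hc 0 h0).mono Ioo_subset_Ico_self
  obtain ⟨ε, hε, hball⟩ : ∃ ε > 0, ∀ r ∈ Ioo (0 : ℝ) ε, r < 1 → g r ≤ g 0 + 1 := by
    obtain ⟨ε, hε, h⟩ := Metric.continuousWithinAt_iff.1 hcw 1 one_pos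
    refine ⟨ε, hε, fun r hr hr1 => ?_⟩
    have := h ⟨hr.1, hr1⟩ (by simpa [abs_of_pos hr.1] using hr.2)
    rw [Real.dist_eq] at this
    linarith [(abs_lt.1 this).2]
  have hmono := ConvexOn.monotoneOn_of_bddAbove_Iio hconv (B := Real.log (g 0 + 1))
    (b₀ := min 0 (Real.log ε)) (by
      intro t ht
      have ht0 : t < 0 := ht.trans_le (min_le_left _ _)
      have ht1 : t < Real.log ε := ht.trans_le (min_le_right _ _)
      refine Real.log_le_log (hpos _ (hexp' t ht0)) (hball _ ⟨Real.exp_pos t, ?_⟩ (hexp t ht0).2)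
      rwa [← Real.lt_log_iff_exp_lt hε])
  have hmonoOo : ∀ r ∈ Ioo (0 : ℝ) 1, ∀ r' ∈ Ioo (0 : ℝ) 1, r ≤ r' → g r ≤ g r' := by
    intro r hr r' hr' hrr
    have := hmono (Real.log_neg hr.1 hr.2) (Real.log_neg hr'.1 hr'.2)
      (Real.log_le_log hr.1 hrr)
    simp only [Real.exp_log hr.1, Real.exp_log hr'.1] at this
    exact (Real.log_le_log_iff (hpos _ (Ioo_subset_Ico_self hr))
      (hpos _ (Ioo_subset_Ico_self hr'))).1 this
  intro r hr r' hr' hrr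
  rcases hr.1.eq_or_lt with rfl | hr0
  · rcases hr'.1.eq_or_lt with h | hr'0
    · rw [← h]
    · have : (nhdsWithin (0 : ℝ) (Ioo 0 1)).NeBot := by
        rw [← mem_closure_iff_nhdsWithin_neBot, closure_Ioo zero_ne_one]
        simp
      refine le_of_tendsto hcw ?_
      filter_upwards [self_mem_nhdsWithin, nhdsWithin_le_nhds (Iio_mem_nhds hr'0)] with x hx hxr
      exact hmonoOo x hx r' ⟨hr'0, hr'.2⟩ hxr.le
  · exact hmonoOo r ⟨hr0, hr.2⟩ r' ⟨hr0.trans_le hrr, hr'.2⟩ hrr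

/-! ### Square means over spheres and Cauchy–Schwarz. -/

theorem smul_sphere_mem_ball {E : Type*} [NormedAddCommGroup E] [NormedSpace ℝ E]
    {r : ℝ} (hr : r ∈ Ico (0 : ℝ) 1) (y : Metric.sphere (0 : E) 1) :
    r • (y : E) ∈ Metric.ball (0 : E) 1 := by
  simpa [norm_smul, abs_of_nonneg hr.1] using hr.2

theorem Continuous.integrable_of_compactSpace {X F : Type*} [TopologicalSpace X] [CompactSpace X]
    [MeasurableSpace X] [OpensMeasurableSpace X] [NormedAddCommGroup F] {μ : Measure X}
    [IsFiniteMeasure μ] {g : X → F} (hg : Continuous g) : Integrable g μ :=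
  hg.integrable_of_hasCompactSupport (HasCompactSupport.of_compactSpace g)

theorem sq_integral_inner_le {X : Type*} [TopologicalSpace X] [CompactSpace X] [MeasurableSpace X]
    [OpensMeasurableSpace X] {μ : Measure X} [IsFiniteMeasure μ] {F : Type*}
    [NormedAddCommGroup F] [InnerProductSpace ℝ F] {f g : X → F} (hf : Continuous f)
    (hg : Continuous g) :
    (∫ x, inner ℝ (f x) (g x) ∂μ) ^ 2 ≤ (∫ x, ‖f x‖ ^ 2 ∂μ) * ∫ x, ‖g x‖ ^ 2 ∂μ := by
  have hint : ∀ {h : X → ℝ}, Continuous h → Integrable h μ := fun hh =>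
    hh.integrable_of_compactSpace
  have hq : ∀ t : ℝ, 0 ≤ (∫ x, ‖f x‖ ^ 2 ∂μ) * (t * t) + 2 * (∫ x, inner ℝ (f x) (g x) ∂μ) * t +
      ∫ x, ‖g x‖ ^ 2 ∂μ := by
    intro t
    have h1 : 0 ≤ ∫ x, ‖t • f x + g x‖ ^ 2 ∂μ := integral_nonneg fun _ => by positivity
    have h2 : ∀ x, ‖t • f x + g x‖ ^ 2 =
        (‖f x‖ ^ 2 * (t * t) + (inner ℝ (f x) (g x)) * (2 * t)) + ‖g x‖ ^ 2 := by
      intro x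
      rw [norm_add_sq_real, norm_smul, inner_smul_left, mul_pow, Real.norm_eq_abs, sq_abs]
      simp
      ring
    simp_rw [h2] at h1
    rw [integral_add (hint (by fun_prop)) (hint (by fun_prop)),
      integral_add (hint (by fun_prop)) (hint (by fun_prop)), integral_mul_const,
      integral_mul_const] at h1
    linarith
  have := discrim_le_zero hq
  rw [discrim] at this
  nlinarith

theorem continuous_comp_smul_sphere {E F : Type*} [NormedAddCommGroup E] [NormedSpace ℝ E]
    [TopologicalSpace F] {f : E → F} (hf : ContinuousOn f (Metric.ball 0 1)) {r : ℝ}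
    (hr : r ∈ Ico (0 : ℝ) 1) : Continuous fun y : Metric.sphere (0 : E) 1 => f (r • (y : E)) :=
  hf.comp_continuous (by fun_prop) (smul_sphere_mem_ball hr)

section SphereMeans

variable {E F : Type*} [NormedAddCommGroup E] [InnerProductSpace ℝ E]
  [FiniteDimensional ℝ E] [MeasurableSpace E] [BorelSpace E] [NormedAddCommGroup F]

theorem L2Mean_nonneg (f : E → F) (r : ℝ) : 0 ≤ L2Mean f r :=
  Real.sqrt_nonneg _

theorem L2Mean_sq (f : E → F) (r : ℝ) :
    L2Mean f r ^ 2 = ((volume : Measure E).toSphere.real univ)⁻¹ *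
      ∫ y : Metric.sphere (0 : E) 1, ‖f (r • (y : E))‖ ^ 2 ∂(volume : Measure E).toSphere := by
  rw [L2Mean, Real.sq_sqrt, average_eq, smul_eq_mul]
  rw [average_eq, smul_eq_mul]
  exact mul_nonneg (by positivity) (integral_nonneg fun _ => by positivity)

theorem continuousOn_integral_sphere {μ : Measure (Metric.sphere (0 : E) 1)} [IsFiniteMeasure μ]
    {f : E → F} (hf : ContinuousOn f (Metric.ball 0 1)) :
    ContinuousOn (fun r : ℝ => ∫ y : Metric.sphere (0 : E) 1, ‖f (r • (y : E))‖ ^ 2 ∂μ)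
      (Ico 0 1) := by
  refine continuousOn_integral_of_compact_support (k := univ) isCompact_univ ?_ (by simp)
  have h : ContinuousOn (fun p : ℝ × Metric.sphere (0 : E) 1 => f (p.1 • (p.2 : E)))
      (Ico 0 1 ×ˢ univ) :=
    hf.comp (by fun_prop) fun p hp => smul_sphere_mem_ball hp.1 p.2
  exact h.norm.pow 2

variable [InnerProductSpace ℝ F]

/-- `hk` is all that is needed from harmonicity or holomorphy beyond continuity, so both cases share
this argument. The weight is the square root of the sum of squared means; it inherits unboundedness
from `w`. -/
theorem exists_logConvex_weight_of_integral_inner {J : ℕ} {f : Fin J → E → F} {w : ℝ → ℝ}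
    (hw : IsWeightFunction w) (hf : ∀ j, ContinuousOn (f j) (Metric.ball 0 1))
    (hk : ∀ j, ∀ s ∈ Ioo (0 : ℝ) 1, ∀ u ∈ Ioo (0 : ℝ) 1,
      ∫ y : Metric.sphere (0 : E) 1, inner ℝ (f j (s • (y : E))) (f j (u • (y : E)))
        ∂(volume : Measure E).toSphere =
      ∫ y : Metric.sphere (0 : E) 1, ‖f j (√(s * u) • (y : E))‖ ^ 2
        ∂(volume : Measure E).toSphere)
    (h : EquivOnUnitInterval (fun r => ∑ j, L2Mean (f j) r ^ 2) (fun r => w r ^ 2)) :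
    ∃ v : ℝ → ℝ, IsWeightFunction v ∧ IsLogConvex v ∧ EquivOnUnitInterval w v := by
  obtain ⟨C₁, C₂, hC₁, hC₂, hC⟩ := h
  set g : ℝ → ℝ := fun r => ∑ j, L2Mean (f j) r ^ 2 with hgdef
  have hgpos : ∀ r ∈ Ico (0 : ℝ) 1, 0 < g r := fun r hr => by
    have h1 := (hC r hr).2
    have h2 := pow_pos (hw.pos r hr) 2
    exact pos_of_mul_pos_right (h2.trans_le h1) hC₂.le
  have hgc : ContinuousOn g (Ico 0 1) := by
    refine continuousOn_finsetSum _ fun j _ => ?_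
    simp_rw [L2Mean_sq]
    exact continuousOn_const.mul (continuousOn_integral_sphere (hf j))
  have hgm : ∀ s ∈ Ioo (0 : ℝ) 1, ∀ u ∈ Ioo (0 : ℝ) 1, g (√(s * u)) ^ 2 ≤ g s * g u := by
    intro s hs u hu
    have hj : ∀ j, L2Mean (f j) (√(s * u)) ^ 2 ≤ L2Mean (f j) s * L2Mean (f j) u := by
      intro j
      refine abs_le_of_sq_le_sq' ?_ (mul_nonneg (L2Mean_nonneg _ _) (L2Mean_nonneg _ _)) |>.2
      rw [mul_pow, L2Mean_sq, L2Mean_sq, L2Mean_sq, ← hk j s hs u hu, mul_pow, mul_mul_mul_comm,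
        ← sq]
      exact mul_le_mul_of_nonneg_left (sq_integral_inner_le
        (continuous_comp_smul_sphere (hf j) (Ioo_subset_Ico_self hs))
        (continuous_comp_smul_sphere (hf j) (Ioo_subset_Ico_self hu))) (by positivity)
    calc g (√(s * u)) ^ 2 ≤ (∑ j, L2Mean (f j) s * L2Mean (f j) u) ^ 2 :=
          pow_le_pow_left₀ (Finset.sum_nonneg fun _ _ => by positivity)
            (Finset.sum_le_sum fun j _ => hj j) 2
      _ ≤ g s * g u := Finset.sum_mul_sq_le_sq_mul_sq _ _ _
  obtain ⟨hmono, hlc⟩ := monotoneOn_and_isLogConvex_of_sq_le_mul hgc hgpos hgm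
  have hequiv : ∀ r ∈ Ico (0 : ℝ) 1, (√C₂)⁻¹ * w r ≤ √(g r) ∧ √(g r) ≤ (√C₁)⁻¹ * w r := by
    intro r hr
    obtain ⟨h1, h2⟩ := hC r hr
    have hwr := (hw.pos r hr).le
    constructor
    · rw [inv_mul_le_iff₀ (by positivity), ← Real.sqrt_mul hC₂.le]
      exact Real.le_sqrt_of_sq_le h2
    · rw [le_inv_mul_iff₀ (by positivity), ← Real.sqrt_mul hC₁.le]
      exact Real.sqrt_le_iff.2 ⟨hwr, h1⟩
  refine ⟨fun r => √(g r), ⟨fun r hr => Real.sqrt_pos.2 (hgpos r hr),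
    fun r hr r' hr' hrr => Real.sqrt_le_sqrt (hmono hr hr' hrr), hgc.sqrt, ?_⟩, ?_,
    (√C₂)⁻¹, (√C₁)⁻¹, by positivity, by positivity, hequiv⟩
  · rintro ⟨B, hB⟩
    refine hw.unbounded ⟨√C₂ * B, ?_⟩
    rintro _ ⟨r, hr, rfl⟩
    have h1 := (hequiv r hr).1
    rw [inv_mul_le_iff₀ (by positivity)] at h1
    exact h1.trans (mul_le_mul_of_nonneg_left (hB ⟨r, hr, rfl⟩) (by positivity))
  · have := hlc.smul (c := (1 / 2 : ℝ)) (by norm_num)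
    refine this.congr fun t ht => ?_
    have ht' : Real.exp t ∈ Ico (0 : ℝ) 1 := ⟨(Real.exp_pos t).le, Real.exp_lt_one_iff.2 ht⟩
    simp only [smul_eq_mul]
    rw [Real.log_sqrt (hgpos _ ht').le]
    ring

end SphereMeans

/-! ### Green's identity in smeared form. -/

open Laplacian Topology in
theorem laplacian_comp_clm {E G : Type*} [NormedAddCommGroup E] [InnerProductSpace ℝ E]
    [FiniteDimensional ℝ E] [NormedAddCommGroup G] [NormedSpace ℝ G] {ι : Type*} [Fintype ι]
    (b : OrthonormalBasis ι ℝ E) {f : G → ℝ} (L : E →L[ℝ] G) {x : E}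
    (hf : ContDiffAt ℝ 2 f (L x)) :
    (Δ fun z => f (L z)) x = ∑ i, iteratedFDeriv ℝ 2 f (L x) ![L (b i), L (b i)] := by
  rw [InnerProductSpace.laplacian_eq_iteratedFDeriv_orthonormalBasis _ b]
  refine Finset.sum_congr rfl fun i _ => ?_
  rw [iteratedFDeriv_two_apply, iteratedFDeriv_two_apply]
  have h1 : fderiv ℝ (fun z => f (L z)) =ᶠ[𝓝 x] fun z => (fderiv ℝ f (L z)).comp L := by
    have := L.continuous.continuousAt.eventually (hf.eventually (by simp))
    filter_upwards [this] with z hz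
    exact ((hz.differentiableAt (by simp)).hasFDerivAt.comp z L.hasFDerivAt).fderiv
  have h2 : HasFDerivAt (fderiv ℝ f) (fderiv ℝ (fderiv ℝ f) (L x)) (L x) :=
    ((hf.fderiv_right (m := 1) (by norm_num)).differentiableAt (by simp)).hasFDerivAt
  have h3 := (h2.comp x L.hasFDerivAt).clm_comp (hasFDerivAt_const L x)
  rw [h1.fderiv_eq, HasFDerivAt.fderiv (f := fun z => (fderiv ℝ f (L z)).comp L) h3]
  simp

theorem hasCompactSupport_of_norm_gt {E : Type*} [NormedAddCommGroup E] [ProperSpace E]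
    {φ : E → ℝ} {ρ : ℝ}
    (h : ∀ x, ρ < ‖x‖ → φ x = 0) : HasCompactSupport φ := by
  refine HasCompactSupport.of_support_subset_isCompact (isCompact_closedBall (0 : E) ρ) ?_
  intro x hx
  by_contra hx'
  exact hx (h x (by simpa using hx'))

section Green

variable {E : Type*} [NormedAddCommGroup E] [InnerProductSpace ℝ E] [FiniteDimensional ℝ E]

open InnerProductSpace

theorem HarmonicOnNhd.comp_smul {f : E → ℝ} {c : ℝ}
    {R R' : ℝ} (hf : HarmonicOnNhd f (Metric.ball 0 R)) (hR : ∀ x : E, ‖x‖ < R' → ‖c • x‖ < R) :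
    HarmonicOnNhd (fun x => f (c • x)) (Metric.ball 0 R') := by
  have hC : ∀ x ∈ Metric.ball (0 : E) R', ContDiffAt ℝ 2 f (c • x) := fun x hx =>
    (hf (c • x) (by simpa using hR x (by simpa using hx))).1
  intro x hx
  refine ⟨(hC x hx).comp x (by fun_prop), ?_⟩
  filter_upwards [Metric.isOpen_ball.mem_nhds hx] with z hz
  have h := laplacian_comp_clm (stdOrthonormalBasis ℝ E) (f := f)
    (c • ContinuousLinearMap.id ℝ E) (x := z) (by simpa using hC z hz)
  have h0 := (hf (c • z) (by simpa using hR z (by simpa using hz))).2.self_of_nhds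
  rw [laplacian_eq_iteratedFDeriv_orthonormalBasis _ (stdOrthonormalBasis ℝ E)] at h0
  simp only [iteratedFDeriv_two_apply] at h h0
  simp only [smul_apply, ContinuousLinearMap.id_apply, map_smul,
    smul_eq_mul, Matrix.cons_val_zero, Matrix.cons_val_one, Pi.zero_apply] at h h0 ⊢
  rw [h, ← Finset.mul_sum, ← Finset.mul_sum, h0]
  simp

variable {F H : E → ℝ} {R : ℝ}

theorem contDiffAt_fderiv_apply (hF : HarmonicOnNhd F (Metric.ball 0 R)) {x : E}
    (hx : x ∈ Metric.ball (0 : E) R) (v : E) : ContDiffAt ℝ 1 (fun x => fderiv ℝ F x v) x :=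
  ((hF x hx).1.fderiv_right (m := 1) (by norm_num)).clm_apply contDiffAt_const

theorem continuousOn_fderiv_apply_self (hF : HarmonicOnNhd F (Metric.ball 0 R)) :
    ContinuousOn (fun x => fderiv ℝ F x x) (Metric.ball 0 R) := fun x hx =>
  (((hF x hx).1.fderiv_right (m := 1) (by norm_num)).clm_apply
    contDiffAt_id).continuousAt.continuousWithinAt

theorem continuousOn_flux (hF : HarmonicOnNhd F (Metric.ball 0 R))
    (hH : HarmonicOnNhd H (Metric.ball 0 R)) :
    ContinuousOn (fun x => fderiv ℝ F x x * H x - F x * fderiv ℝ H x x) (Metric.ball 0 R) :=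
  ((continuousOn_fderiv_apply_self hF).mul hH.continuousOn).sub
    (hF.continuousOn.mul (continuousOn_fderiv_apply_self hH))

theorem integral_fderiv_apply_eq_zero [MeasurableSpace E] [BorelSpace E] {φ : E → ℝ}
    (hφ : ContDiff ℝ 1 φ) (hc : HasCompactSupport φ) (v : E) : ∫ x, fderiv ℝ φ x v = 0 := by
  have h := integral_mul_fderiv_eq_neg_fderiv_mul_of_integrable (𝕜 := ℝ) (μ := volume)
    (f := fun _ : E => (1 : ℝ)) (g := φ) (v := v) (by simp)
    (by simpa using ((hφ.continuous_fderiv (by simp)).clm_apply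
      continuous_const).integrable_of_hasCompactSupport (hc.fderiv_apply ℝ v))
    (by simpa using hφ.continuous.integrable_of_hasCompactSupport hc)
    (by simp) fun x _ => hφ.differentiable (by simp) x
  simpa using h

/-- The field `Θ(‖x‖²)(H∇F - F∇H)` has compact support, so its divergence integrates to zero. Since
`F` and `H` are harmonic, only the derivative of the cutoff contributes, and it produces the radial
flux. -/
theorem integral_cutoff_mul_flux_eq_zero [MeasurableSpace E] [BorelSpace E]
    (hF : HarmonicOnNhd F (Metric.ball 0 R)) (hH : HarmonicOnNhd H (Metric.ball 0 R))
    {Θ θ : ℝ → ℝ} (hΘ : ∀ q, HasDerivAt Θ (θ q) q) (hθ : Continuous θ) {ρ : ℝ} (hρ0 : 0 < ρ)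
    (hρ : ρ < R) (hΘ0 : ∀ q, ρ ^ 2 ≤ q → Θ q = 0) (hθ0 : ∀ q, ρ ^ 2 ≤ q → θ q = 0) :
    ∫ x : E, θ (‖x‖ ^ 2) * (fderiv ℝ F x x * H x - F x * fderiv ℝ H x x) = 0 := by
  set b := stdOrthonormalBasis ℝ E
  set φ : E → E → ℝ := fun v x => Θ (‖x‖ ^ 2) * (fderiv ℝ F x v * H x - F x * fderiv ℝ H x v)
    with hφdef
  have hzero : ∀ v x, ρ < ‖x‖ → φ v x = 0 := fun v x hx => by
    simp only [hφdef]
    rw [hΘ0 _ (by gcongr), zero_mul]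
  have hΘC : ContDiff ℝ 1 Θ := by
    rw [contDiff_one_iff_deriv]
    refine ⟨fun q => (hΘ q).differentiableAt, ?_⟩
    rwa [show deriv Θ = θ from funext fun q => (hΘ q).deriv]
  have hloc : ∀ v x, R ≤ ‖x‖ → φ v =ᶠ[nhds x] fun _ => 0 := fun v x hx => by
    have : ∀ᶠ z : E in nhds x, ρ < ‖z‖ := continuous_norm.continuousAt.eventually
      (lt_mem_nhds (hρ.trans_le hx))
    filter_upwards [this] with z hz using hzero v z hz
  have hφ : ∀ v, ContDiff ℝ 1 (φ v) := by
    intro v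
    rw [contDiff_iff_contDiffAt]
    intro x
    by_cases hx : x ∈ Metric.ball (0 : E) R
    · exact (hΘC.contDiffAt.comp x (contDiff_norm_sq ℝ).contDiffAt).mul
        (((contDiffAt_fderiv_apply hF hx v).mul ((hH x hx).1.of_le (by norm_num))).sub
        (((hF x hx).1.of_le (by norm_num)).mul (contDiffAt_fderiv_apply hH hx v)))
    · exact contDiffAt_const.congr_of_eventuallyEq (hloc v x (by simpa using hx))
  have hcs : ∀ v, HasCompactSupport (φ v) := fun v => hasCompactSupport_of_norm_gt (hzero v)
  have hint : ∀ i, Integrable (fun x => fderiv ℝ (φ (b i)) x (b i)) := fun i =>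
    (((hφ (b i)).continuous_fderiv (by simp)).clm_apply
      continuous_const).integrable_of_hasCompactSupport ((hcs (b i)).fderiv_apply ℝ (b i))
  have hsum : ∫ x, ∑ i, fderiv ℝ (φ (b i)) x (b i) = 0 := by
    rw [integral_finsetSum _ fun i _ => hint i]
    exact Finset.sum_eq_zero fun i _ => integral_fderiv_apply_eq_zero (hφ _) (hcs _) _
  -- The products of first derivatives of `F` and `H` cancel, and the pure second derivatives add up
  -- to Laplacians, which vanish.
  have hpt : ∀ x, ∑ i, fderiv ℝ (φ (b i)) x (b i) =
      2 * (θ (‖x‖ ^ 2) * (fderiv ℝ F x x * H x - F x * fderiv ℝ H x x)) := by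
    intro x
    by_cases hx : x ∈ Metric.ball (0 : E) R
    · have hFx := (hF x hx).1
      have hHx := (hH x hx).1
      have hF2 : HasFDerivAt (fderiv ℝ F) (fderiv ℝ (fderiv ℝ F) x) x :=
        ((hFx.fderiv_right (m := 1) (by norm_num)).differentiableAt (by simp)).hasFDerivAt
      have hH2 : HasFDerivAt (fderiv ℝ H) (fderiv ℝ (fderiv ℝ H) x) x :=
        ((hHx.fderiv_right (m := 1) (by norm_num)).differentiableAt (by simp)).hasFDerivAt
      have hF1 := (hFx.differentiableAt (by simp)).hasFDerivAt
      have hH1 := (hHx.differentiableAt (by simp)).hasFDerivAt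
      have hN : HasFDerivAt (fun x : E => ‖x‖ ^ 2) (2 • (innerSL ℝ x)) x :=
        (hasStrictFDerivAt_norm_sq x).hasFDerivAt
      have hterm : ∀ v, fderiv ℝ (φ v) x v =
          2 * θ (‖x‖ ^ 2) * (inner ℝ x v * (fderiv ℝ F x v * H x - F x * fderiv ℝ H x v)) +
          Θ (‖x‖ ^ 2) * (fderiv ℝ (fderiv ℝ F) x v v * H x -
            F x * fderiv ℝ (fderiv ℝ H) x v v) := by
        intro v
        have hFv := hF2.clm_apply (hasFDerivAt_const v x)
        have hHv := hH2.clm_apply (hasFDerivAt_const v x)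
        have := ((hΘ (‖x‖ ^ 2)).comp_hasFDerivAt x hN).mul ((hFv.mul hH1).sub (hF1.mul hHv))
        rw [HasFDerivAt.fderiv (f := φ v) this]
        simp
        ring
      have hlap : ∀ {f : E → ℝ}, HarmonicOnNhd f (Metric.ball 0 R) →
          ∑ i, fderiv ℝ (fderiv ℝ f) x (b i) (b i) = 0 := by
        intro f hf
        have h0 := (hf x hx).2.self_of_nhds
        rw [laplacian_eq_iteratedFDeriv_orthonormalBasis _ b] at h0
        simpa [iteratedFDeriv_two_apply] using h0
      have hrad : ∀ f : E → ℝ, ∑ i, inner ℝ x (b i) * fderiv ℝ f x (b i) = fderiv ℝ f x x := by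
        intro f
        have h := congrArg (fderiv ℝ f x) (b.sum_repr' x)
        simpa [map_sum, real_inner_comm] using h
      simp_rw [hterm]
      rw [Finset.sum_add_distrib, ← Finset.mul_sum, ← Finset.mul_sum, Finset.sum_sub_distrib,
        ← Finset.sum_mul, ← Finset.mul_sum, hlap hF, hlap hH]
      have : ∑ i, inner ℝ x (b i) * (fderiv ℝ F x (b i) * H x - F x * fderiv ℝ H x (b i)) =
          fderiv ℝ F x x * H x - F x * fderiv ℝ H x x := by
        rw [← hrad F, ← hrad H, Finset.sum_mul, Finset.mul_sum, ← Finset.sum_sub_distrib]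
        exact Finset.sum_congr rfl fun i _ => by ring
      rw [this]
      ring
    · have hx' : R ≤ ‖x‖ := by simpa using hx
      rw [hθ0 _ (by gcongr; linarith)]
      simp only [zero_mul, mul_zero]
      refine Finset.sum_eq_zero fun i _ => ?_
      rw [(hloc (b i) x hx').fderiv_eq]
      simp
  simp_rw [hpt] at hsum
  rw [integral_const_mul] at hsum
  linarith

end Green

/-! ### Flux through the unit sphere and the pairing of dilates. -/

section Flux

variable {E : Type*} [NormedAddCommGroup E] [InnerProductSpace ℝ E] [FiniteDimensional ℝ E]
  [MeasurableSpace E] [BorelSpace E] [Nontrivial E]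

open InnerProductSpace

theorem integrable_and_integral_eq_integral_sphere {φ : E → ℝ} (hφ : Integrable φ) :
    Integrable (fun r : Ioi (0 : ℝ) => ∫ y : Metric.sphere (0 : E) 1, φ ((r : ℝ) • (y : E))
      ∂(volume : Measure E).toSphere) (Measure.volumeIoiPow (Module.finrank ℝ E - 1)) ∧
    ∫ x, φ x = ∫ r : Ioi (0 : ℝ), ∫ y : Metric.sphere (0 : E) 1, φ ((r : ℝ) • (y : E))
      ∂(volume : Measure E).toSphere ∂(Measure.volumeIoiPow (Module.finrank ℝ E - 1)) := by
  set Φ : Metric.sphere (0 : E) 1 × Ioi (0 : ℝ) → ℝ := fun p => φ ((p.2 : ℝ) • (p.1 : E)) with hΦ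
  have hcomp : ∀ x : ({0}ᶜ : Set E), Φ (homeomorphUnitSphereProd E x) = φ x := by
    intro x
    simp only [hΦ]
    have hx : ‖(x : E)‖ ≠ 0 := norm_ne_zero_iff.2 x.2
    simp [smul_smul, hx]
  have hmp := (volume : Measure E).measurePreserving_homeomorphUnitSphereProd
  have hemb := Homeomorph.measurableEmbedding (homeomorphUnitSphereProd E)
  have h1 : ∫ x, φ x = ∫ p, Φ p ∂((volume : Measure E).toSphere.prod
      (.volumeIoiPow (Module.finrank ℝ E - 1))) := by
    rw [← hmp.integral_comp hemb]
    simp_rw [hcomp]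
    rw [integral_subtype_comap (measurableSet_singleton _).compl fun x ↦ φ x,
      restrict_compl_singleton]
  have h2 : Integrable Φ ((volume : Measure E).toSphere.prod
      (.volumeIoiPow (Module.finrank ℝ E - 1))) := by
    rw [← hmp.integrable_comp_emb hemb]
    have : Φ ∘ homeomorphUnitSphereProd E = φ ∘ ((↑) : ({0}ᶜ : Set E) → E) := funext hcomp
    rw [this, ← integrableOn_iff_comap_subtypeVal (measurableSet_singleton _).compl]
    exact hφ.integrableOn
  exact ⟨h2.swap.integral_prod_left, by rw [h1, integral_prod_symm _ h2]⟩

theorem volumeIoiPow_Ico_pos (n : ℕ) {a b : Ioi (0 : ℝ)} (hab : a < b) :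
    0 < Measure.volumeIoiPow n (Ico a b) := by
  by_contra! h
  have h1 : Measure.volumeIoiPow n (Iio b) ≤ Measure.volumeIoiPow n (Iio a) := by
    calc _ ≤ Measure.volumeIoiPow n (Iio a ∪ Ico a b) :=
          measure_mono fun x hx => (lt_or_ge x a).imp id fun h => ⟨h, hx⟩
      _ ≤ _ := (measure_union_le _ _).trans (by simp [le_antisymm h bot_le])
  rw [Measure.volumeIoiPow_apply_Iio, Measure.volumeIoiPow_apply_Iio] at h1
  have ha : (0 : ℝ) < a := a.2
  have hab' : (a : ℝ) < b := hab
  rw [ENNReal.ofReal_le_ofReal_iff (by positivity)] at h1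
  have : (a : ℝ) ^ (n + 1) < (b : ℝ) ^ (n + 1) := by gcongr
  have := div_lt_div_of_pos_right this (c := (n + 1 : ℝ)) (by positivity)
  linarith

variable {F H : E → ℝ} {R : ℝ}

/-- If the flux at radius `1` were positive, it would be positive at nearby radii, and a bump in the
radius concentrated there would contradict the smeared identity in polar coordinates. The opposite
sign follows by exchanging `F` and `H`. -/
theorem integral_sphere_flux_nonpos (hR : 1 < R) (hF : HarmonicOnNhd F (Metric.ball 0 R))
    (hH : HarmonicOnNhd H (Metric.ball 0 R)) :
    ∫ y : Metric.sphere (0 : E) 1, (fderiv ℝ F y y * H y - F y * fderiv ℝ H y y)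
      ∂(volume : Measure E).toSphere ≤ 0 := by
  set V : E → ℝ := fun x => fderiv ℝ F x x * H x - F x * fderiv ℝ H x x with hV
  have hVc : ContinuousOn V (Metric.ball 0 R) := continuousOn_flux hF hH
  set W : ℝ → ℝ := fun r => ∫ y : Metric.sphere (0 : E) 1, V (r • (y : E))
    ∂(volume : Measure E).toSphere with hW
  have hWc : ContinuousOn W (Ioo 0 R) := by
    refine continuousOn_integral_of_compact_support (k := univ) isCompact_univ ?_ (by simp)
    refine hVc.comp (by fun_prop) fun p hp => ?_
    simpa [norm_smul, abs_of_pos hp.1.1] using hp.1.2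
  suffices W 1 ≤ 0 by simpa [hW] using this
  by_contra! hpos
  obtain ⟨δ, hδ, hδpos⟩ : ∃ δ > 0, ∀ r ∈ Ioo (0 : ℝ) R, |r - 1| < δ → 0 < W r := by
    have := (hWc.continuousAt (Ioo_mem_nhds one_pos hR)).eventually (lt_mem_nhds hpos)
    obtain ⟨δ, hδ, h⟩ := Metric.eventually_nhds_iff.1 this
    exact ⟨δ, hδ, fun r _ hr => h hr⟩
  -- The tent `θ` is taken in the variable `q = r²`. As `|r² - 1| ≥ |r - 1|`, it is supported in `|r
  -- - 1| ≤ ε`: where `W` is positive (up to the endpoints), by `ε ≤ δ`, and inside the ball of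
  -- harmonicity, by `ε ≤ (R - 1) / 2`.
  set ε := min (min δ (1 / 2)) ((R - 1) / 2)
  have hε : 0 < ε := lt_min (lt_min hδ (by norm_num)) (by linarith)
  have hεδ : ε ≤ δ := (min_le_left _ _).trans (min_le_left _ _)
  have hε2 : ε ≤ 1 / 2 := (min_le_left _ _).trans (min_le_right _ _)
  have hεR : ε ≤ (R - 1) / 2 := min_le_right _ _
  set θ : ℝ → ℝ := fun q => max 0 (ε - |q - 1|) with hθdef
  have hθ : Continuous θ := by fun_prop
  have hθ0 : ∀ q, (1 + ε) ^ 2 ≤ q → θ q = 0 := fun q hq => by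
    have := le_abs_self (q - 1)
    exact max_eq_left (by nlinarith)
  have hθsupp : ∀ r : ℝ, 0 < r → ε ≤ |r - 1| → θ (r ^ 2) = 0 := fun r hr h => by
    refine max_eq_left ?_
    rw [show r ^ 2 - 1 = (r - 1) * (r + 1) by ring, abs_mul, abs_of_pos (by linarith : 0 < r + 1)]
    nlinarith
  set Θ : ℝ → ℝ := fun q => ∫ t in (1 + ε) ^ 2..q, θ t with hΘdef
  have hΘ : ∀ q, HasDerivAt Θ (θ q) q := fun q =>
    intervalIntegral.integral_hasDerivAt_right (hθ.intervalIntegrable _ _)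
      hθ.aestronglyMeasurable.stronglyMeasurableAtFilter hθ.continuousAt
  have hΘ0 : ∀ q, (1 + ε) ^ 2 ≤ q → Θ q = 0 := fun q hq => by
    rw [hΘdef]
    refine intervalIntegral.integral_zero_ae (Filter.Eventually.of_forall fun t ht => ?_)
    rw [uIoc_of_le hq] at ht
    exact hθ0 t ht.1.le
  have hzero := integral_cutoff_mul_flux_eq_zero hF hH hΘ hθ (by linarith) (by linarith) hΘ0 hθ0
  set φ : E → ℝ := fun x => θ (‖x‖ ^ 2) * V x with hφdef
  have hφ0 : ∀ x, 1 + ε < ‖x‖ → φ x = 0 := fun x hx => by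
    simp only [hφdef]
    rw [hθ0 _ (by gcongr), zero_mul]
  have hφc : Continuous φ := by
    rw [continuous_iff_continuousAt]
    intro x
    by_cases hx : x ∈ Metric.ball (0 : E) R
    · exact (by fun_prop : Continuous fun x : E => θ (‖x‖ ^ 2)).continuousAt.mul
        (hVc.continuousAt (Metric.isOpen_ball.mem_nhds hx))
    · have hx' : R ≤ ‖x‖ := by simpa using hx
      refine (continuousAt_const (y := (0 : ℝ))).congr ?_
      have : ∀ᶠ z : E in nhds x, 1 + ε < ‖z‖ := continuous_norm.continuousAt.eventually
        (lt_mem_nhds (by linarith))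
      filter_upwards [this] with z hz using (hφ0 z hz).symm
  have hφi : Integrable φ :=
    hφc.integrable_of_hasCompactSupport (hasCompactSupport_of_norm_gt hφ0)
  obtain ⟨hi, he⟩ := integrable_and_integral_eq_integral_sphere hφi
  have hpolar : ∀ r : Ioi (0 : ℝ), ∫ y : Metric.sphere (0 : E) 1, φ ((r : ℝ) • (y : E))
      ∂(volume : Measure E).toSphere = θ ((r : ℝ) ^ 2) * W r := by
    intro r
    have hr : (0 : ℝ) < r := r.2
    simp only [hφdef, hW]
    rw [← integral_const_mul]
    refine integral_congr_ae (Filter.Eventually.of_forall fun y => ?_)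
    simp [norm_smul, abs_of_pos hr]
  simp_rw [hpolar] at hi he
  rw [hzero] at he
  have hWpos : ∀ r : Ioi (0 : ℝ), |(r : ℝ) - 1| < ε → 0 < W r := fun r hr =>
    hδpos r ⟨r.2, by linarith [(abs_lt.1 hr).2]⟩ (hr.trans_le hεδ)
  have hnn : ∀ r : Ioi (0 : ℝ), 0 ≤ θ ((r : ℝ) ^ 2) * W r := fun r => by
    rcases lt_or_ge |(r : ℝ) - 1| ε with h | h
    · exact mul_nonneg (le_max_left _ _) (hWpos r h).le
    · rw [hθsupp r r.2 h, zero_mul]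
  have hae := (integral_eq_zero_iff_of_nonneg hnn hi).1 he.symm
  have hIco := volumeIoiPow_Ico_pos (Module.finrank ℝ E - 1)
    (a := ⟨1, mem_Ioi.2 one_pos⟩) (b := ⟨1 + ε / 4, by simp only [mem_Ioi]; linarith⟩)
    (Subtype.mk_lt_mk.2 (by linarith))
  refine hIco.ne' (measure_mono_null (fun r hr => ?_) hae)
  have h1 : (1 : ℝ) ≤ r := hr.1
  have h2 : (r : ℝ) < 1 + ε / 4 := hr.2
  have h3 : 0 < θ ((r : ℝ) ^ 2) := by
    refine lt_max_of_lt_right ?_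
    rw [abs_of_nonneg (by nlinarith)]
    nlinarith
  have h4 := hWpos r (by rw [abs_of_nonneg (by linarith)]; linarith)
  exact (mul_pos h3 h4).ne'

theorem integral_sphere_flux_eq_zero (hR : 1 < R) (hF : HarmonicOnNhd F (Metric.ball 0 R))
    (hH : HarmonicOnNhd H (Metric.ball 0 R)) :
    ∫ y : Metric.sphere (0 : E) 1, (fderiv ℝ F y y * H y - F y * fderiv ℝ H y y)
      ∂(volume : Measure E).toSphere = 0 := by
  refine le_antisymm (integral_sphere_flux_nonpos hR hF hH) ?_
  have h := integral_sphere_flux_nonpos hR hH hF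
  rw [← neg_nonpos, ← integral_neg]
  refine le_of_eq_of_le (integral_congr_ae (Filter.Eventually.of_forall fun y => ?_)) h
  ring

/-- Move the radii to `s e^a` and `u e^{-a}`, which keeps their product. The derivative in `a` of
the pairing is the flux of the two dilates of `f` through the unit sphere, hence zero. The two sides
are the values at `a = 0` and at the `a` that makes the radii equal. -/
theorem integral_sphere_mul_of_harmonic {f : E → ℝ} (hf : HarmonicOnNhd f (Metric.ball 0 1))
    {s u : ℝ} (hs : s ∈ Ioo (0 : ℝ) 1) (hu : u ∈ Ioo (0 : ℝ) 1) :
    ∫ y : Metric.sphere (0 : E) 1, f (s • (y : E)) * f (u • (y : E))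
        ∂(volume : Measure E).toSphere =
      ∫ y : Metric.sphere (0 : E) 1, f (√(s * u) • (y : E)) ^ 2
        ∂(volume : Measure E).toSphere := by
  -- Exactly the `a` for which both radii stay below `1`.
  set I : Set ℝ := Ioo (Real.log u) (-Real.log s) with hI
  have hIs : ∀ a ∈ I, s * Real.exp a ∈ Ioo (0 : ℝ) 1 := fun a ha =>
    ⟨mul_pos hs.1 (Real.exp_pos a), by
      rw [← Real.exp_log hs.1, ← Real.exp_add, Real.exp_lt_one_iff]; linarith [ha.2]⟩
  have hIu : ∀ a ∈ I, u * Real.exp (-a) ∈ Ioo (0 : ℝ) 1 := fun a ha =>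
    ⟨mul_pos hu.1 (Real.exp_pos _), by
      rw [← Real.exp_log hu.1, ← Real.exp_add, Real.exp_lt_one_iff]; linarith [ha.1]⟩
  have hball : ∀ c ∈ Ioo (0 : ℝ) 1, ∀ y : Metric.sphere (0 : E) 1,
      c • (y : E) ∈ Metric.ball (0 : E) 1 := fun c hc y =>
    smul_sphere_mem_ball (Ioo_subset_Ico_self hc) y
  set D : E → ℝ := fun x => fderiv ℝ f x x with hD
  have hDc : ContinuousOn D (Metric.ball 0 1) := continuousOn_fderiv_apply_self hf
  set k : ℝ → Metric.sphere (0 : E) 1 → ℝ := fun a y =>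
    f ((s * Real.exp a) • (y : E)) * f ((u * Real.exp (-a)) • (y : E)) with hk
  set k' : ℝ → Metric.sphere (0 : E) 1 → ℝ := fun a y =>
    D ((s * Real.exp a) • (y : E)) * f ((u * Real.exp (-a)) • (y : E)) -
      f ((s * Real.exp a) • (y : E)) * D ((u * Real.exp (-a)) • (y : E)) with hk'
  have hcs : ∀ {g : E → ℝ}, ContinuousOn g (Metric.ball 0 1) → ContinuousOn
      (fun p : ℝ × Metric.sphere (0 : E) 1 => g ((s * Real.exp p.1) • (p.2 : E)))
      (I ×ˢ univ) := fun hg => hg.comp (by fun_prop) fun p hp => hball _ (hIs _ hp.1) _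
  have hcu : ∀ {g : E → ℝ}, ContinuousOn g (Metric.ball 0 1) → ContinuousOn
      (fun p : ℝ × Metric.sphere (0 : E) 1 => g ((u * Real.exp (-p.1)) • (p.2 : E)))
      (I ×ˢ univ) := fun hg => hg.comp (by fun_prop) fun p hp => hball _ (hIu _ hp.1) _
  have hkc : ContinuousOn (fun p : ℝ × Metric.sphere (0 : E) 1 => k p.1 p.2) (I ×ˢ univ) :=
    (hcs hf.continuousOn).mul (hcu hf.continuousOn)
  have hkc' : ContinuousOn (fun p : ℝ × Metric.sphere (0 : E) 1 => k' p.1 p.2) (I ×ˢ univ) :=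
    ((hcs hDc).mul (hcu hf.continuousOn)).sub ((hcs hf.continuousOn).mul (hcu hDc))
  have hslice : ∀ {q : ℝ → Metric.sphere (0 : E) 1 → ℝ},
      ContinuousOn (fun p : ℝ × Metric.sphere (0 : E) 1 => q p.1 p.2) (I ×ˢ univ) →
      ∀ a ∈ I, Continuous (q a) := fun hq a ha =>
    hq.comp_continuous (f := fun y => (a, y)) (by fun_prop) fun y => ⟨ha, mem_univ _⟩
  have hray : ∀ c ∈ Ioo (0 : ℝ) 1, ∀ y : Metric.sphere (0 : E) 1, ∀ {l : ℝ → ℝ} {l' a : ℝ},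
      l a = c → HasDerivAt l (l' * c) a →
      HasDerivAt (fun a => f (l a • (y : E))) (l' * D (c • (y : E))) a := by
    intro c hc y l l' a hla hl
    have h1 := ((hf _ (hball c hc y)).1.differentiableAt (by simp)).hasFDerivAt
    rw [← hla] at h1 hl
    have := h1.comp_hasDerivAt a (hl.smul_const (y : E))
    rw [← hla]
    exact this.congr_deriv (by simp [hD, mul_smul])
  have hderiv : ∀ a ∈ I, ∀ y, HasDerivAt (fun a => k a y) (k' a y) a := by
    intro a ha y
    have h1 := hray _ (hIs a ha) y (l := fun a => s * Real.exp a) (l' := 1) (a := a) rfl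
      (by simpa using (Real.hasDerivAt_exp a).const_mul s)
    have h2 := hray _ (hIu a ha) y (l := fun a => u * Real.exp (-a)) (l' := -1) (a := a) rfl
      (by simpa using ((Real.hasDerivAt_exp (-a)).comp a (hasDerivAt_neg a)).const_mul u)
    exact (h1.mul h2).congr_deriv (by simp only [hk']; ring)
  have hint : ∀ a ∈ I, HasDerivAt
      (fun a => ∫ y, k a y ∂(volume : Measure E).toSphere) 0 a := by
    intro a ha
    obtain ⟨η, hη, hηI⟩ := Metric.nhds_basis_closedBall.mem_iff.1 (isOpen_Ioo.mem_nhds ha)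
    obtain ⟨B, hB⟩ := ((isCompact_closedBall a η).prod
      (isCompact_univ (X := Metric.sphere (0 : E) 1))).exists_bound_of_continuousOn
        (hkc'.mono (prod_mono hηI Subset.rfl))
    have h := hasDerivAt_integral_of_dominated_loc_of_deriv_le
      (μ := (volume : Measure E).toSphere) (F := k) (F' := k') (x₀ := a) (bound := fun _ => B)
      (Metric.closedBall_mem_nhds a hη)
      (Filter.eventually_of_mem (isOpen_Ioo.mem_nhds ha) fun a' ha' =>
        (hslice hkc a' ha').aestronglyMeasurable)
      ((hslice hkc a ha).integrable_of_compactSpace)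
      ((hslice hkc' a ha).aestronglyMeasurable)
      (Filter.Eventually.of_forall fun y a' ha' => hB (a', y) ⟨ha', mem_univ _⟩)
      (integrable_const _)
      (Filter.Eventually.of_forall fun y a' ha' => hderiv a' (hηI ha') y)
    refine h.2.congr_deriv ?_
    -- Both radii are below `1`, so both dilates are harmonic on a ball of radius larger than `1`.
    obtain ⟨R, hR1, hRs, hRu⟩ : ∃ R > 1, R * (s * Real.exp a) ≤ 1 ∧ R * (u * Real.exp (-a)) ≤ 1 := by
      have h1 := hIs a ha
      have h2 := hIu a ha
      refine ⟨min (s * Real.exp a)⁻¹ (u * Real.exp (-a))⁻¹,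
        lt_min ((one_lt_inv₀ h1.1).2 h1.2) ((one_lt_inv₀ h2.1).2 h2.2), ?_, ?_⟩
      · rw [← le_div_iff₀ h1.1, one_div]; exact min_le_left _ _
      · rw [← le_div_iff₀ h2.1, one_div]; exact min_le_right _ _
    have hscale : ∀ c, c ∈ Ioo (0 : ℝ) 1 → R * c ≤ 1 →
        HarmonicOnNhd (fun x : E => f (c • x)) (Metric.ball 0 R) := fun c hc hRc =>
      HarmonicOnNhd.comp_smul hf fun x hx => by
        rw [norm_smul, Real.norm_eq_abs, abs_of_pos hc.1]
        nlinarith [hc.1]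
    rw [← integral_sphere_flux_eq_zero hR1 (hscale _ (hIs a ha) hRs) (hscale _ (hIu a ha) hRu)]
    have hfd : ∀ c, c ∈ Ioo (0 : ℝ) 1 → ∀ y : Metric.sphere (0 : E) 1,
        fderiv ℝ (fun x : E => f (c • x)) y y = D (c • (y : E)) := by
      intro c hc y
      have h1 := ((hf _ (hball c hc y)).1.differentiableAt (by simp)).hasFDerivAt
      have h2 : HasFDerivAt (fun x : E => c • x) (c • ContinuousLinearMap.id ℝ E) (y : E) :=
        (hasFDerivAt_id (y : E)).const_smul c
      have h3 : HasFDerivAt (fun x : E => f (c • x)) _ (y : E) := h1.comp (y : E) h2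
      rw [h3.fderiv]
      simp [hD]
    refine integral_congr_ae (Filter.Eventually.of_forall fun y => ?_)
    simp only [hk']
    rw [hfd _ (hIs a ha), hfd _ (hIu a ha)]
  have hconst : ∀ a ∈ I, ∀ b ∈ I, (∫ y, k a y ∂(volume : Measure E).toSphere) =
      ∫ y, k b y ∂(volume : Measure E).toSphere := by
    intro a ha b hb
    exact isOpen_Ioo.is_const_of_deriv_eq_zero isPreconnected_Ioo
      (fun x hx => (hint x hx).differentiableAt.differentiableWithinAt)
      (fun x hx => (hint x hx).deriv) ha hb
  have hls := Real.log_neg hs.1 hs.2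
  have hlu := Real.log_neg hu.1 hu.2
  have h0 : (0 : ℝ) ∈ I := ⟨hlu, by linarith⟩
  have hm : (Real.log u - Real.log s) / 2 ∈ I := ⟨by linarith, by linarith⟩
  have hsq : √(s * u) = Real.exp ((Real.log s + Real.log u) / 2) := by
    rw [Real.exp_half, Real.exp_add, Real.exp_log hs.1, Real.exp_log hu.1]
  have he1 : s * Real.exp ((Real.log u - Real.log s) / 2) = √(s * u) := by
    rw [hsq]; nth_rewrite 1 [← Real.exp_log hs.1]; rw [← Real.exp_add]; ring_nf
  have he2 : u * Real.exp (-((Real.log u - Real.log s) / 2)) = √(s * u) := by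
    rw [hsq]; nth_rewrite 1 [← Real.exp_log hu.1]; rw [← Real.exp_add]; ring_nf
  have := hconst 0 h0 _ hm
  simp only [hk, he1, he2] at this
  simpa [sq] using this

end Flux

/-! ### Invariance of the surface measure under isometries. -/

section SphereRotation

variable {E : Type*} [NormedAddCommGroup E] [InnerProductSpace ℝ E] [FiniteDimensional ℝ E]
  [MeasurableSpace E] [BorelSpace E]

/-- The action of a linear isometry on the unit sphere. -/
def LinearIsometryEquiv.sphereMap {E : Type*} [NormedAddCommGroup E] [NormedSpace ℝ E]
    (U : E ≃ₗᵢ[ℝ] E) (y : Metric.sphere (0 : E) 1) :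
    Metric.sphere (0 : E) 1 := ⟨U y, by simp⟩

theorem LinearIsometryEquiv.continuous_sphereMap {E : Type*} [NormedAddCommGroup E]
    [NormedSpace ℝ E] (U : E ≃ₗᵢ[ℝ] E) : Continuous U.sphereMap := by
  unfold LinearIsometryEquiv.sphereMap
  fun_prop

-- The surface measure of a set comes from the volume of the cone over it, and taking cones commutes
-- with `U`.
open scoped Pointwise in
theorem LinearIsometryEquiv.measurePreserving_sphereMap (U : E ≃ₗᵢ[ℝ] E) :
    MeasurePreserving U.sphereMap (volume : Measure E).toSphere (volume : Measure E).toSphere := by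
  refine ⟨U.continuous_sphereMap.measurable, Measure.ext fun s hs => ?_⟩
  rw [Measure.map_apply U.continuous_sphereMap.measurable hs, Measure.toSphere_apply' _ hs,
    Measure.toSphere_apply' _ (U.continuous_sphereMap.measurable hs)]
  congr 1
  have : Ioo (0 : ℝ) 1 • (((↑) : Metric.sphere (0 : E) 1 → E) '' (U.sphereMap ⁻¹' s)) =
      U ⁻¹' (Ioo (0 : ℝ) 1 • (((↑) : Metric.sphere (0 : E) 1 → E) '' s)) := by
    ext x
    simp only [mem_smul, mem_preimage, mem_image]
    constructor
    · rintro ⟨r, hr, _, ⟨y, hy, rfl⟩, rfl⟩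
      exact ⟨r, hr, _, ⟨_, hy, rfl⟩, by simp [sphereMap]⟩
    · rintro ⟨r, hr, _, ⟨y, hy, rfl⟩, h⟩
      refine ⟨r, hr, _, ⟨U.symm.sphereMap y, ?_, rfl⟩, ?_⟩
      · simpa [sphereMap] using hy
      · apply U.injective
        simpa [sphereMap] using h
  rw [this]
  exact U.measurePreserving.measure_preimage_emb U.toHomeomorph.measurableEmbedding _

theorem integral_sphere_comp_isometry {G : Type*} [NormedAddCommGroup G] [NormedSpace ℝ G]
    (U : E ≃ₗᵢ[ℝ] E) {g : E → G} (hg : Continuous fun y : Metric.sphere (0 : E) 1 => g y) :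
    ∫ y : Metric.sphere (0 : E) 1, g (U y) ∂(volume : Measure E).toSphere =
      ∫ y : Metric.sphere (0 : E) 1, g y ∂(volume : Measure E).toSphere := by
  have h := U.measurePreserving_sphereMap
  conv_rhs => rw [← h.map_eq]
  rw [integral_map h.measurable.aemeasurable hg.aestronglyMeasurable]
  rfl

end SphereRotation

/-! ### The pairing identity on circles in the disc. -/

section Disc

open ComplexConjugate

theorem circle_average_annulus {q : ℂ → ℂ} {a b : ℝ} (ha : 0 ≤ a)
    (hq : ∀ z : ℂ, ‖z‖ ∈ Ioo a b → DifferentiableAt ℂ q z) {r R : ℝ} (hr : r ∈ Ioo a b)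
    (hR : R ∈ Ioo a b) :
    ∫ θ in (0 : ℝ)..2 * Real.pi, q (circleMap 0 r θ) =
      ∫ θ in (0 : ℝ)..2 * Real.pi, q (circleMap 0 R θ) := by
  wlog hle : r ≤ R generalizing r R
  · exact (this hR hr (le_of_not_ge hle)).symm
  have hr0 : 0 < r := ha.trans_lt hr.1
  have h := Complex.circleIntegral_sub_center_inv_smul_eq_of_differentiable_on_annulus_off_countable
    (c := 0) (f := q) hr0 hle countable_empty
    (fun z hz => (hq z (by
      simp only [mem_sdiff, Metric.mem_closedBall, dist_zero_right, Metric.mem_ball, not_lt] at hz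
      exact ⟨hr.1.trans_le hz.2, hz.1.trans_lt hR.2⟩)).continuousAt.continuousWithinAt)
    (fun z hz => hq z (by
      simp only [mem_sdiff, Metric.mem_closedBall, dist_zero_right, Metric.mem_ball, not_le] at hz
      exact ⟨hr.1.trans hz.1.2, hz.1.1.trans hR.2⟩))
  have hcirc : ∀ ρ : ℝ, 0 < ρ → (∮ z in C(0, ρ), (z - 0)⁻¹ • q z) =
      Complex.I * ∫ θ in (0 : ℝ)..2 * Real.pi, q (circleMap 0 ρ θ) := by
    intro ρ hρ
    rw [circleIntegral, ← intervalIntegral.integral_const_mul]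
    refine intervalIntegral.integral_congr fun θ _ => ?_
    have : circleMap 0 ρ θ ≠ 0 := circleMap_ne_center hρ.ne'
    simp only [deriv_circleMap, sub_zero, smul_eq_mul]
    field_simp
  rw [hcirc _ hr0, hcirc _ (hr0.trans_le hle)] at h
  exact (mul_left_cancel₀ Complex.I_ne_zero h).symm

/-- The function `conj (F (conj (s / z))) * F (u z)` is holomorphic on `s < |z| < 1/u`, so its
circle averages do not depend on the radius. Radius `1` gives the pairing at `s` and `u`; radius `√s
/ √u` gives both arguments modulus `√(su)`. -/
theorem integral_circle_inner {F : ℂ → ℂ} (hF : DifferentiableOn ℂ F (Metric.ball 0 1))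
    {s u : ℝ} (hs : s ∈ Ioo (0 : ℝ) 1) (hu : u ∈ Ioo (0 : ℝ) 1) :
    ∫ θ in (0 : ℝ)..2 * Real.pi, inner ℝ (F (circleMap 0 s θ)) (F (circleMap 0 u θ)) =
      ∫ θ in (0 : ℝ)..2 * Real.pi, ‖F (circleMap 0 √(s * u) θ)‖ ^ 2 := by
  have hFd : ∀ z : ℂ, ‖z‖ < 1 → DifferentiableAt ℂ F z := fun z hz =>
    hF.differentiableAt (Metric.isOpen_ball.mem_nhds (by simpa using hz))
  set q : ℂ → ℂ := fun z => conj (F (conj ((s : ℂ) / z))) * F (u * z) with hq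
  have hqd : ∀ z : ℂ, ‖z‖ ∈ Ioo s u⁻¹ → DifferentiableAt ℂ q z := by
    intro z hz
    have hz0 : 0 < ‖z‖ := hs.1.trans hz.1
    have h1 : ‖(s : ℂ) / z‖ < 1 := by
      rw [norm_div, Complex.norm_real, Real.norm_eq_abs, abs_of_pos hs.1, div_lt_one hz0]
      exact hz.1
    have h2 : ‖(u : ℂ) * z‖ < 1 := by
      rw [norm_mul, Complex.norm_real, Real.norm_eq_abs, abs_of_pos hu.1,
        ← lt_inv_mul_iff₀ hu.1, mul_one]
      exact hz.2
    have h3 : DifferentiableAt ℂ (conj ∘ F ∘ conj) ((s : ℂ) / z) := by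
      have := (hFd (conj ((s : ℂ) / z)) (by rwa [Complex.norm_conj])).conj_conj
      rwa [Complex.conj_conj] at this
    refine DifferentiableAt.mul (h3.comp z ?_) ((hFd _ h2).comp z (by fun_prop))
    exact (differentiableAt_const _).div differentiableAt_id (norm_pos_iff.1 hz0)
  have hval : ∀ ρ : ℝ, 0 < ρ → ∀ θ, q (circleMap 0 ρ θ) =
      conj (F (circleMap 0 (s / ρ) θ)) * F (circleMap 0 (u * ρ) θ) := by
    intro ρ hρ θ
    have h1 : conj ((s : ℂ) / circleMap 0 ρ θ) = circleMap 0 (s / ρ) θ := by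
      simp only [circleMap_zero, map_div₀, map_mul, Complex.conj_ofReal, ← Complex.exp_conj,
        Complex.conj_I]
      rw [mul_neg, Complex.exp_neg]
      have := Complex.exp_ne_zero (θ * Complex.I)
      have : (ρ : ℂ) ≠ 0 := by exact_mod_cast hρ.ne'
      push_cast
      field_simp
    have h2 : (u : ℂ) * circleMap 0 ρ θ = circleMap 0 (u * ρ) θ := by
      simp only [circleMap_zero]; push_cast; ring
    simp only [hq]
    rw [h1, h2]
  have h1 : (1 : ℝ) ∈ Ioo s u⁻¹ := ⟨hs.2, (one_lt_inv₀ hu.1).2 hu.2⟩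
  have hsq : √(s * u) = √s * √u := Real.sqrt_mul hs.1.le u
  have hss : √s * √s = s := Real.mul_self_sqrt hs.1.le
  have huu : √u * √u = u := Real.mul_self_sqrt hu.1.le
  have hs' : 0 < √s := Real.sqrt_pos.2 hs.1
  have hu' : 0 < √u := Real.sqrt_pos.2 hu.1
  have hs1 : √s < 1 := by nlinarith [hs.2]
  have hu1 : √u < 1 := by nlinarith [hu.2]
  have h2 : √s / √u ∈ Ioo s u⁻¹ := by
    constructor
    · rw [lt_div_iff₀ hu']; nlinarith
    · rw [div_lt_iff₀ hu', inv_mul_eq_div, lt_div_iff₀ hu.1]; nlinarith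
  have h := circle_average_annulus hs.1.le hqd h1 h2
  simp_rw [hval 1 one_pos, hval _ (hs.1.trans h2.1)] at h
  have e1 : s / (√s / √u) = √(s * u) := by rw [hsq]; field_simp; nlinarith
  have e2 : u * (√s / √u) = √(s * u) := by rw [hsq]; field_simp; nlinarith
  rw [e1, e2] at h
  simp only [div_one, mul_one] at h
  have hcont : ∀ {r : ℝ}, r ∈ Ioo (0 : ℝ) 1 → Continuous fun θ : ℝ => F (circleMap 0 r θ) :=
    fun hr => hF.continuousOn.comp_continuous (continuous_circleMap 0 _) fun θ => by
      simpa [abs_of_pos hr.1] using hr.2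
  have hre := congrArg Complex.re h
  have hsu : √(s * u) ∈ Ioo (0 : ℝ) 1 := by
    rw [hsq]; exact ⟨mul_pos hs' hu', by nlinarith⟩
  have hRe : ∀ {r ρ : ℝ}, r ∈ Ioo (0 : ℝ) 1 → ρ ∈ Ioo (0 : ℝ) 1 →
      (∫ θ in (0 : ℝ)..2 * Real.pi, conj (F (circleMap 0 r θ)) * F (circleMap 0 ρ θ)).re =
      ∫ θ in (0 : ℝ)..2 * Real.pi, inner ℝ (F (circleMap 0 r θ)) (F (circleMap 0 ρ θ)) := by
    intro r ρ hr hρ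
    have hc : Continuous fun θ : ℝ => conj (F (circleMap 0 r θ)) * F (circleMap 0 ρ θ) :=
      (Complex.continuous_conj.comp (hcont hr)).mul (hcont hρ)
    have := Complex.reCLM.intervalIntegral_comp_comm
      (hc.intervalIntegrable (μ := volume) 0 (2 * Real.pi))
    simp only [Complex.reCLM_apply] at this
    rw [← this]
    refine intervalIntegral.integral_congr fun θ _ => ?_
    simp only [Complex.inner]
    rw [mul_comm]
  rw [hRe hs hu, hRe hsu hsu] at hre
  rw [hre]
  simp_rw [real_inner_self_eq_norm_sq]

end Disc

/-! ### The pairing identity on complex spheres. -/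

section Holomorphic

variable {m : ℕ}

/-- Multiplication by `e^{iθ}` as a real linear isometry of `ℂ^m`. -/
noncomputable def phaseRotation (m : ℕ) (θ : ℝ) :
    EuclideanSpace ℂ (Fin m) ≃ₗᵢ[ℝ] EuclideanSpace ℂ (Fin m) :=
  LinearIsometry.toLinearIsometryEquiv
    { toFun := fun z => Complex.exp (θ * Complex.I) • z
      map_add' := fun x y => smul_add _ x y
      map_smul' := fun c x => smul_comm _ c x
      norm_map' := fun x => by
        change ‖Complex.exp (θ * Complex.I) • x‖ = ‖x‖
        rw [norm_smul, Complex.norm_exp_ofReal_mul_I, one_mul] } rfl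

theorem phaseRotation_apply (θ : ℝ) (z : EuclideanSpace ℂ (Fin m)) :
    phaseRotation m θ z = Complex.exp (θ * Complex.I) • z := rfl

/-- Multiplication by `e^{iθ}` preserves the surface measure, so averaging over `θ` and Fubini
reduce the claim to the disc functions `z ↦ f (z • y)`. -/
theorem integral_sphere_inner_of_holomorphic {f : EuclideanSpace ℂ (Fin m) → ℂ}
    (hf : DifferentiableOn ℂ f (Metric.ball 0 1)) {s u : ℝ} (hs : s ∈ Ioo (0 : ℝ) 1)
    (hu : u ∈ Ioo (0 : ℝ) 1) :
    ∫ y : Metric.sphere (0 : EuclideanSpace ℂ (Fin m)) 1,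
        inner ℝ (f (s • (y : EuclideanSpace ℂ (Fin m)))) (f (u • (y : EuclideanSpace ℂ (Fin m))))
        ∂(volume : Measure (EuclideanSpace ℂ (Fin m))).toSphere =
      ∫ y : Metric.sphere (0 : EuclideanSpace ℂ (Fin m)) 1,
        ‖f (√(s * u) • (y : EuclideanSpace ℂ (Fin m)))‖ ^ 2
        ∂(volume : Measure (EuclideanSpace ℂ (Fin m))).toSphere := by
  have hsm : ∀ (r θ : ℝ) (y : EuclideanSpace ℂ (Fin m)),
      r • phaseRotation m θ y = circleMap 0 r θ • y := fun r θ y => by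
    rw [phaseRotation_apply, circleMap_zero, mul_smul, Complex.coe_smul]
  have hcball : ∀ {r : ℝ}, r ∈ Ioo (0 : ℝ) 1 → ∀ (θ : ℝ)
      (y : Metric.sphere (0 : EuclideanSpace ℂ (Fin m)) 1),
      circleMap 0 r θ • (y : EuclideanSpace ℂ (Fin m)) ∈ Metric.ball 0 1 := fun hr θ y => by
    simpa [norm_smul, abs_of_pos hr.1] using hr.2
  have key : ∀ {r ρ : ℝ}, r ∈ Ioo (0 : ℝ) 1 → ρ ∈ Ioo (0 : ℝ) 1 →
      (2 * Real.pi) * (∫ y : Metric.sphere (0 : EuclideanSpace ℂ (Fin m)) 1,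
        inner ℝ (f (r • (y : EuclideanSpace ℂ (Fin m)))) (f (ρ • (y : EuclideanSpace ℂ (Fin m))))
        ∂(volume : Measure (EuclideanSpace ℂ (Fin m))).toSphere) =
      ∫ y : Metric.sphere (0 : EuclideanSpace ℂ (Fin m)) 1, (∫ θ in (0 : ℝ)..2 * Real.pi,
        inner ℝ (f (circleMap 0 r θ • (y : EuclideanSpace ℂ (Fin m))))
          (f (circleMap 0 ρ θ • (y : EuclideanSpace ℂ (Fin m)))))
        ∂(volume : Measure (EuclideanSpace ℂ (Fin m))).toSphere := by
    intro r ρ hr hρ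
    have hjc : ∀ {r : ℝ}, r ∈ Ioo (0 : ℝ) 1 → Continuous
        fun p : ℝ × Metric.sphere (0 : EuclideanSpace ℂ (Fin m)) 1 =>
          f (circleMap 0 r p.1 • (p.2 : EuclideanSpace ℂ (Fin m))) := fun hr =>
      hf.continuousOn.comp_continuous (by fun_prop) fun p => hcball hr p.1 p.2
    rw [← intervalIntegral_integral_swap]
    · rw [intervalIntegral.integral_congr (g := fun _ => ∫ y : Metric.sphere
        (0 : EuclideanSpace ℂ (Fin m)) 1, inner ℝ (f (r • (y : EuclideanSpace ℂ (Fin m))))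
          (f (ρ • (y : EuclideanSpace ℂ (Fin m))))
        ∂(volume : Measure (EuclideanSpace ℂ (Fin m))).toSphere)]
      · simp
      · intro θ _
        have hc : Continuous fun y : Metric.sphere (0 : EuclideanSpace ℂ (Fin m)) 1 =>
            inner ℝ (f (r • (y : EuclideanSpace ℂ (Fin m))))
              (f (ρ • (y : EuclideanSpace ℂ (Fin m)))) :=
          (continuous_comp_smul_sphere hf.continuousOn (Ioo_subset_Ico_self hr)).inner
            (continuous_comp_smul_sphere hf.continuousOn (Ioo_subset_Ico_self hρ))
        have := integral_sphere_comp_isometry (phaseRotation m θ)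
          (g := fun y => inner ℝ (f (r • y)) (f (ρ • y))) hc
        simp only [hsm] at this
        exact this
    · rw [← Measure.restrict_univ (μ := (volume : Measure (EuclideanSpace ℂ (Fin m))).toSphere),
        Measure.prod_restrict]
      refine IntegrableOn.mono_set (t := Icc 0 (2 * Real.pi) ×ˢ univ) ?_ (prod_mono ?_ le_rfl)
      · exact ((hjc hr).inner (hjc hρ)).continuousOn.integrableOn_compact
          (isCompact_Icc.prod isCompact_univ)
      · rw [uIoc_of_le (by positivity)]
        exact Ioc_subset_Icc_self
  have hsu : √(s * u) ∈ Ioo (0 : ℝ) 1 :=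
    ⟨Real.sqrt_pos.2 (mul_pos hs.1 hu.1), (Real.sqrt_lt' one_pos).2 (by nlinarith [hs.2, hu.2, hu.1])⟩
  refine mul_left_cancel₀ (by positivity : 2 * Real.pi ≠ 0) ?_
  have h2 := key hsu hsu
  simp_rw [real_inner_self_eq_norm_sq] at h2
  rw [h2, key hs hu]
  refine integral_congr_ae (Filter.Eventually.of_forall fun y => ?_)
  refine integral_circle_inner (F := fun z => f (z • (y : EuclideanSpace ℂ (Fin m)))) ?_ hs hu
  refine hf.comp (by fun_prop) fun z hz => ?_
  simpa [norm_smul] using hz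

end Holomorphic

/-! ### Lines supporting a convex function from below. -/

section Polygon

variable {ψ : ℝ → ℝ} {c : ℝ}

/-- Take the steepest line through `(x, ψ x - c)` that stays below `ψ` to the right of `x`; it
touches `ψ` at `t`. Raised by `c`, it starts on the graph, lies above it at `t`, and meets it again
at `x'` because `ψ` is unbounded. -/
theorem exists_supporting_line (hc : 0 < c) (hcont : ContinuousOn ψ (Iio 0))
    (hmono : MonotoneOn ψ (Iio 0)) (hunb : ∀ B, ∃ τ < 0, B < ψ τ) {x : ℝ} (hx : x < 0) :
    ∃ p t x', 0 < p ∧ x < t ∧ t < x' ∧ x' < 0 ∧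
      (∀ τ, x < τ → τ < 0 → ψ x - c + p * (τ - x) ≤ ψ τ) ∧
      ψ t = ψ x - c + p * (t - x) ∧ ψ x' = ψ x + p * (x' - x) := by
  set S : ℝ → ℝ := fun τ => (ψ τ - ψ x + c) / (τ - x) with hS
  have hnum : ∀ τ, x < τ → τ < 0 → c ≤ ψ τ - ψ x + c := fun τ h1 h2 => by
    linarith [hmono hx h2 h1.le]
  set B := S (x / 2) with hB
  have hx2 : x < x / 2 := by linarith
  have hx20 : x / 2 < 0 := by linarith
  have hBpos : 0 < B := div_pos (hc.trans_le (hnum _ hx2 hx20)) (by linarith)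
  obtain ⟨η, hη0, hη⟩ := hunb (ψ x - c + B * (-x))
  -- Outside `[a, e]` the slope quotient `S` is at least `B = S (x / 2)`: near `x` because its
  -- numerator is at least `c`, near `0` because `ψ` is large. So a minimum over `[a, e]` is global.
  set a := min (x + c / B) (x / 2)
  have hxa : x < a := lt_min (by linarith [div_pos hc hBpos]) hx2
  set e := max η (x / 2)
  have he0 : e < 0 := max_lt hη0 hx20
  have hae : x / 2 ∈ Icc a e := ⟨min_le_right _ _, le_max_right _ _⟩
  have hSc : ContinuousOn S (Icc a e) := by
    refine ContinuousOn.div ?_ (by fun_prop) fun τ hτ => by linarith [hτ.1]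
    have : ContinuousOn ψ (Icc a e) := hcont.mono fun τ hτ => hτ.2.trans_lt he0
    fun_prop
  obtain ⟨t, ht, htmin⟩ := isCompact_Icc.exists_isMinOn ⟨_, hae⟩ hSc
  have hxt : x < t := hxa.trans_le ht.1
  have ht0 : t < 0 := ht.2.trans_lt he0
  have hSmin : ∀ τ, x < τ → τ < 0 → S t ≤ S τ := by
    intro τ h1 h2
    have htB : S t ≤ B := htmin hae
    by_cases hτa : τ < a
    · refine htB.trans ?_
      rw [hS, le_div_iff₀ (by linarith)]
      have h3 : τ - x ≤ c / B := by linarith [min_le_left (x + c / B) (x / 2)]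
      calc B * (τ - x) ≤ B * (c / B) := by gcongr
        _ = c := mul_div_cancel₀ _ hBpos.ne'
        _ ≤ _ := hnum τ h1 h2
    by_cases hτe : e < τ
    · refine htB.trans ?_
      rw [hS, le_div_iff₀ (by linarith)]
      have h3 : ψ η ≤ ψ τ := hmono hη0 h2 ((le_max_left _ _).trans hτe.le)
      have h4 : B * (τ - x) ≤ B * (-x) := by gcongr; linarith
      linarith
    · exact htmin ⟨not_lt.1 hτa, not_lt.1 hτe⟩
  have hpt : S t * (t - x) = ψ t - ψ x + c := div_mul_cancel₀ _ (by linarith)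
  have hp : 0 < S t := div_pos (hc.trans_le (hnum _ hxt ht0)) (by linarith)
  obtain ⟨η', hη'0, hη'⟩ := hunb (ψ x + S t * (-x))
  set τ₁ := max η' t
  have hτ₁ : τ₁ < 0 := max_lt hη'0 ht0
  have hDc : ContinuousOn (fun τ => ψ τ - S t * (τ - x)) (Icc t τ₁) := by
    have : ContinuousOn ψ (Icc t τ₁) := hcont.mono fun τ hτ => hτ.2.trans_lt hτ₁
    fun_prop
  have hmem : ψ x ∈ Ioc (ψ t - S t * (t - x)) (ψ τ₁ - S t * (τ₁ - x)) := by
    constructor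
    · linarith
    · have h3 : ψ η' ≤ ψ τ₁ := hmono hη'0 hτ₁ (le_max_left _ _)
      have h4 : S t * (τ₁ - x) ≤ S t * (-x) := by gcongr; linarith
      linarith
  obtain ⟨x', hx', hx'e⟩ := intermediate_value_Ioc (le_max_right _ _) hDc hmem
  refine ⟨S t, t, x', hp, hxt, hx'.1, hx'.2.trans_lt hτ₁, fun τ h1 h2 => ?_, by linarith, ?_⟩
  · have := hSmin τ h1 h2
    rw [hS, le_div_iff₀ (by linarith)] at this
    linarith
  · simp only at hx'e
    linarith

theorem ConvexOn.sub_mul_sub_le (hψ : ConvexOn ℝ (Iio 0) ψ) {a b e : ℝ} (hab : a < b) (hbe : b < e)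
    (he : e < 0) : (ψ b - ψ a) * (e - b) ≤ (ψ e - ψ b) * (b - a) := by
  have h := hψ.slope_mono_adjacent (x := a) (y := b) (z := e)
    (hab.trans (hbe.trans he)) he hab hbe
  rwa [div_le_div_iff₀ (sub_pos.2 hab) (sub_pos.2 hbe)] at h

/-- Iterate the previous construction from `x₀`, each exit point being the next start. Between
consecutive starts, `ψ` lies below its chord, which is the supporting line raised by `c`.
Consecutive lines cross at the common start, and at the neighbouring contact points their gap is at
least `c`, so lines further along the sequence lose `c` per step. The condition `-x₀ ≤ c` makes
consecutive slopes differ by at least `1`. -/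
theorem exists_supporting_lines (hψ : ConvexOn ℝ (Iio 0) ψ) (hmono : MonotoneOn ψ (Iio 0))
    (hunb : ∀ B, ∃ τ < 0, B < ψ τ) {x₀ : ℝ} (hx₀ : x₀ < 0) (hc : -x₀ ≤ c) :
    ∃ p q : ℕ → ℝ, (∀ i, 0 < p i) ∧ (∀ i, p i + 1 ≤ p (i + 1)) ∧ ∀ τ ∈ Ico x₀ 0, ∃ j,
      ψ τ - c ≤ q j + p j * τ ∧
      (∀ k : ℕ, q (j + k) + p (j + k) * τ ≤ ψ τ - (k - 1) * c) ∧
      ∀ i k : ℕ, i + k = j → q i + p i * τ ≤ ψ τ - (k - 1) * c := by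
  have hc0 : 0 < c := by linarith
  choose! P T X hP hT hX hX0 hline htouch hexit using fun x (hx : x < 0) =>
    exists_supporting_line hc0 (hψ.continuousOn isOpen_Iio) hmono hunb hx
  set x : ℕ → ℝ := fun i => X^[i] x₀ with hxdef
  have hxs : ∀ i, x (i + 1) = X (x i) := fun i => Function.iterate_succ_apply' X i x₀
  have hx0 : ∀ i, x i < 0 := by
    intro i
    induction i with
    | zero => exact hx₀
    | succ i ih => rw [hxs]; exact hX0 _ ih
  set p : ℕ → ℝ := fun i => P (x i) with hp
  set t : ℕ → ℝ := fun i => T (x i) with ht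
  have hp0 : ∀ i, 0 < p i := fun i => hP _ (hx0 i)
  have hxt : ∀ i, x i < t i := fun i => hT _ (hx0 i)
  have htx : ∀ i, t i < x (i + 1) := fun i => by rw [hxs]; exact hX _ (hx0 i)
  have ht0 : ∀ i, t i < 0 := fun i => (htx i).trans (hx0 _)
  have hxmono : StrictMono x := strictMono_nat_of_lt_succ fun i => (hxt i).trans (htx i)
  set l : ℕ → ℝ → ℝ := fun i τ => ψ (x i) - c + p i * (τ - x i) with hl
  have hlle : ∀ i τ, x i ≤ τ → τ < 0 → l i τ ≤ ψ τ := fun i τ h1 h2 => by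
    rcases h1.eq_or_lt with rfl | h
    · simp [hl, hc0.le]
    · exact hline _ (hx0 i) τ h h2
  have hlt : ∀ i, ψ (t i) = l i (t i) := fun i => htouch _ (hx0 i)
  have hψx : ∀ i, ψ (x (i + 1)) = ψ (x i) + p i * (x (i + 1) - x i) := fun i => by
    rw [hxs]; exact hexit _ (hx0 i)
  have hdiff : ∀ i τ, l i τ - l (i + 1) τ = (p (i + 1) - p i) * (x (i + 1) - τ) := fun i τ => by
    simp only [hl]; linarith [hψx i]
  -- By convexity the slope of `ψ` from `t i` to `x (i + 1)` is at most that from `x (i + 1)` to `t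
  -- (i + 1)`, which is less than `p (i + 1)`.
  have hleft : ∀ i, l (i + 1) (t i) ≤ l i (t i) - c := by
    intro i
    have h1 := hψ.sub_mul_sub_le (htx i) (hxt (i + 1)) (ht0 _)
    have h2 := hlt (i + 1)
    rw [← hlt i]
    simp only [hl] at h2 ⊢
    have h3 : (ψ (t (i + 1)) - ψ (x (i + 1))) * (x (i + 1) - t i) ≤
        p (i + 1) * (t (i + 1) - x (i + 1)) * (x (i + 1) - t i) :=
      mul_le_mul_of_nonneg_right (by linarith) (by linarith [htx i])
    have h4 : ψ (x (i + 1)) - ψ (t i) ≤ p (i + 1) * (x (i + 1) - t i) := by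
      refine le_of_mul_le_mul_right ?_ (sub_pos.2 (hxt (i + 1)))
      linarith
    linarith
  have hright : ∀ i, l i (t (i + 1)) ≤ l (i + 1) (t (i + 1)) - c := by
    intro i
    have h1 := hψ.sub_mul_sub_le (htx i) (hxt (i + 1)) (ht0 _)
    have h2 := hlt i
    rw [← hlt (i + 1)]
    have h5 := hψx i
    simp only [hl] at h2 ⊢
    have h3 : p i * (x (i + 1) - t i) * (t (i + 1) - x (i + 1)) ≤
        (ψ (x (i + 1)) - ψ (t i)) * (t (i + 1) - x (i + 1)) :=
      mul_le_mul_of_nonneg_right (by linarith) (by linarith [hxt (i + 1)])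
    have h4 : p i * (t (i + 1) - x (i + 1)) ≤ ψ (t (i + 1)) - ψ (x (i + 1)) := by
      refine le_of_mul_le_mul_right ?_ (sub_pos.2 (htx i))
      linarith
    linarith
  have hpc : ∀ i, c ≤ (p (i + 1) - p i) * (x (i + 1) - t i) := fun i => by
    rw [← hdiff]; linarith [hleft i]
  have hpmono : ∀ i, 0 < p (i + 1) - p i := fun i =>
    pos_of_mul_pos_left (hc0.trans_le (hpc i)) (by linarith [htx i])
  have hpstep : ∀ i, p i + 1 ≤ p (i + 1) := fun i => by
    have h1 : x₀ ≤ x i := hxmono.monotone (Nat.zero_le i)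
    have h2 : x (i + 1) - t i ≤ c := by linarith [hx0 (i + 1), hxt i]
    have h3 : c ≤ (p (i + 1) - p i) * c :=
      (hpc i).trans (mul_le_mul_of_nonneg_left h2 (hpmono i).le)
    have h4 : 1 * c ≤ (p (i + 1) - p i) * c := by linarith
    linarith [le_of_mul_le_mul_right h4 hc0]
  have hdecL : ∀ i τ, τ ≤ t i → l (i + 1) τ ≤ l i τ - c := fun i τ h => by
    have h1 := hdiff i τ
    have h2 : (p (i + 1) - p i) * (x (i + 1) - t i) ≤ (p (i + 1) - p i) * (x (i + 1) - τ) :=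
      mul_le_mul_of_nonneg_left (by linarith) (hpmono i).le
    linarith [hpc i]
  have hdecR : ∀ i τ, t (i + 1) ≤ τ → l i τ ≤ l (i + 1) τ - c := fun i τ h => by
    have h1 := hdiff i τ
    have h3 := hdiff i (t (i + 1))
    have h2 : (p (i + 1) - p i) * (x (i + 1) - τ) ≤ (p (i + 1) - p i) * (x (i + 1) - t (i + 1)) :=
      mul_le_mul_of_nonneg_left (by linarith) (hpmono i).le
    linarith [hright i]
  have hpge : ∀ i : ℕ, (i : ℝ) ≤ p i := by
    intro i
    induction i with
    | zero => simpa using (hp0 0).le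
    | succ i ih => push_cast; linarith [hpstep i]
  refine ⟨p, fun i => ψ (x i) - c - p i * x i, hp0, hpstep, fun τ hτ => ?_⟩
  have hq : ∀ i, ψ (x i) - c - p i * x i + p i * τ = l i τ := fun i => by simp only [hl]; ring
  simp only [hq]
  -- The slopes tend to infinity; if no start passed `τ`, the lines would exceed `ψ` at `τ / 2`.
  have hexists : ∃ j, τ < x j := by
    by_contra! hall
    obtain ⟨N, hN⟩ := exists_nat_gt ((ψ (τ / 2) - ψ x₀ + c) / (-τ / 2))
    rw [div_lt_iff₀ (by linarith [hτ.2])] at hN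
    have h1 := hlle N (τ / 2) (by linarith [hall N, hτ.2]) (by linarith [hτ.2])
    have h2 : ψ x₀ ≤ ψ (x N) := hmono hx₀ (hx0 N) (hxmono.monotone (Nat.zero_le N))
    have h3 : p N * (-τ / 2) ≤ p N * (τ / 2 - x N) :=
      mul_le_mul_of_nonneg_left (by linarith [hall N]) (hp0 N).le
    have h4 : N * (-τ / 2) ≤ p N * (-τ / 2) :=
      mul_le_mul_of_nonneg_right (hpge N) (by linarith [hτ.2])
    simp only [hl] at h1
    linarith
  obtain ⟨j, hj1, hj2⟩ : ∃ j, x j ≤ τ ∧ τ < x (j + 1) := by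
    classical
    have hfind := Nat.find_spec hexists
    have hpos : Nat.find hexists ≠ 0 := fun h => by
      rw [h] at hfind
      exact absurd hfind (not_lt.2 hτ.1)
    obtain ⟨j, hj⟩ := Nat.exists_eq_succ_of_ne_zero hpos
    refine ⟨j, not_lt.1 (Nat.find_min hexists (by omega)), ?_⟩
    rw [hj] at hfind
    exact hfind
  have hjle := hlle j τ hj1 hτ.2
  refine ⟨j, ?_, fun k => ?_, fun i k => ?_⟩
  · rcases hj1.eq_or_lt with h | h
    · simp [hl, h]
    · have h1 := hψ.sub_mul_sub_le h hj2 (hx0 _)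
      have h2 := hψx j
      have h3 : (ψ τ - ψ (x j) - p j * (τ - x j)) * (x (j + 1) - x j) ≤ 0 := by
        have : ψ (x (j + 1)) - ψ τ = p j * (x (j + 1) - x j) - (ψ τ - ψ (x j)) := by linarith
        rw [this] at h1
        linarith
      have h4 := nonpos_of_mul_nonpos_left h3 (by linarith)
      simp only [hl]
      linarith
  -- The nearest neighbour gains nothing, since it crosses line `j` at an end of the interval
  -- containing `τ`; this is why the bound has `k - 1`.
  · rcases k with _ | k
    · simp only [add_zero, CharP.cast_eq_zero]; linarith
    · have : ∀ k : ℕ, l (j + (k + 1)) τ ≤ ψ τ - k * c := by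
        intro k
        induction k with
        | zero =>
          have h1 := hdiff j τ
          have h2 := mul_nonneg (hpmono j).le (sub_nonneg.2 hj2.le)
          simp only [zero_add, CharP.cast_eq_zero, zero_mul, sub_zero]
          linarith
        | succ k ih =>
          have h1 : τ ≤ t (j + (k + 1)) := hj2.le.trans
            ((hxmono.monotone (by omega : j + 1 ≤ j + (k + 1))).trans (hxt _).le)
          have := hdecL _ τ h1
          push_cast
          rw [← add_assoc j (k + 1) 1]
          linarith
      have := this k
      push_cast
      linarith
  · rcases k with _ | k
    · rintro rfl
      simp only [CharP.cast_eq_zero] at *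
      have := hlle i τ (by simpa using hj1) hτ.2
      linarith
    · have : ∀ k i : ℕ, i + (k + 1) = j → l i τ ≤ ψ τ - k * c := by
        intro k
        induction k with
        | zero =>
          rintro i rfl
          have h1 := hdiff i τ
          have h2 := mul_nonneg (hpmono i).le (sub_nonneg.2 hj1)
          simp only [zero_add, CharP.cast_eq_zero, zero_mul, sub_zero] at *
          linarith
        | succ k ih =>
          intro i hi
          have h1 : t (i + 1) ≤ τ := ((htx (i + 1)).le.trans
            (hxmono.monotone (by omega : i + 1 + 1 ≤ j))).trans hj1
          have h2 := hdecR i τ h1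
          have h3 := ih (i + 1) (by omega)
          push_cast
          linarith
      intro hi
      have := this k i hi
      push_cast
      linarith

end Polygon

/-! ### A power series comparable to a log-convex weight. -/

section LacunarySeries

theorem summable_and_tsum_le_of_two_sided_geometric {f : ℕ → ℝ} (hf : ∀ i, 0 ≤ f i) {A : ℝ}
    {j : ℕ} (hr : ∀ k, f (j + k) ≤ A * (1 / 2) ^ k) (hl : ∀ i k, i + k = j → f i ≤ A * (1 / 2) ^ k) :
    Summable f ∧ ∑' i, f i ≤ 4 * A := by
  have hgeom : Summable fun k : ℕ => A * (1 / 2 : ℝ) ^ k := summable_geometric_two.mul_left A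
  have hA : 0 ≤ A := by simpa using (hf j).trans (by simpa using hr 0)
  have hs' : Summable fun k => f (k + j) :=
    hgeom.of_nonneg_of_le (fun k => hf _) fun k => by rw [add_comm]; exact hr k
  have hs : Summable f := (summable_nat_add_iff j).1 hs'
  refine ⟨hs, ?_⟩
  rw [← hs.sum_add_tsum_nat_add j]
  have htot : ∑' k : ℕ, A * (1 / 2 : ℝ) ^ k = A * 2 := by rw [tsum_mul_left, tsum_geometric_two]
  have h1 : ∑' k, f (k + j) ≤ A * 2 := by
    rw [← htot]
    exact hs'.tsum_le_tsum (fun k => by rw [add_comm]; exact hr k) hgeom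
  have h2 : ∑ i ∈ Finset.range j, f i ≤ A * 2 := by
    rw [← Finset.sum_range_reflect, ← htot]
    refine (Finset.sum_le_sum fun k hk => ?_).trans
      (hgeom.sum_le_tsum (Finset.range j) fun k _ => by positivity)
    have hk' := Finset.mem_range.1 hk
    refine (hl (j - 1 - k) (k + 1) (by omega)).trans ?_
    rw [pow_succ]
    have : 0 ≤ A * (1 / 2 : ℝ) ^ k := by positivity
    linarith
  linarith

/-- On `[1/2, 1)` the terms are exponentials of supporting lines. With `c = log 2` they decay by a
factor `2` per step on both sides, rounding a slope up costs at most a factor `2`, and slope gaps of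
at least `1` keep the exponents distinct. On `[0, 1/2)` the weight lies between positive constants
and the constant term suffices for the lower bound. -/
theorem exists_lacunary_series {v : ℝ → ℝ} (hv : IsWeightFunction v) (hlc : IsLogConvex v) :
    ∃ (n : ℕ → ℕ) (B : ℕ → ℝ) (c C : ℝ), StrictMono n ∧ n 0 = 0 ∧ (∀ i, 0 < B i) ∧ 0 < c ∧ 0 < C ∧
      ∀ r ∈ Ico (0 : ℝ) 1, (Summable fun i => B i * r ^ n i) ∧
        ∑' i, B i * r ^ n i ≤ C * v r ∧ ∃ i, c * v r ≤ B i * r ^ n i := by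
  have hexp : ∀ t ∈ Iio (0 : ℝ), Real.exp t ∈ Ico (0 : ℝ) 1 := fun t ht =>
    ⟨(Real.exp_pos t).le, Real.exp_lt_one_iff.2 ht⟩
  have hlog2 : 0 < Real.log 2 := Real.log_pos one_lt_two
  set ψ : ℝ → ℝ := fun t => Real.log (v (Real.exp t)) with hψ
  have hmono : MonotoneOn ψ (Iio 0) := fun s hs t ht hst =>
    Real.log_le_log (hv.pos _ (hexp s hs)) (hv.monotoneOn (hexp s hs) (hexp t ht)
      (Real.exp_le_exp.2 hst))
  have hunb : ∀ B, ∃ τ < 0, B < ψ τ := by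
    intro B
    have := hv.unbounded
    rw [not_bddAbove_iff] at this
    obtain ⟨_, ⟨r, hr, rfl⟩, h⟩ := this (max (Real.exp B) (v 0))
    have hr0 : 0 < r := by
      refine hr.1.lt_of_ne fun h0 => ?_
      rw [← h0] at h
      exact absurd h (not_lt.2 (le_max_right _ _))
    refine ⟨Real.log r, Real.log_neg hr0 hr.2, ?_⟩
    simp only [hψ]
    rw [Real.exp_log hr0, Real.lt_log_iff_exp_lt (hv.pos r hr)]
    exact (le_max_left _ _).trans_lt h
  obtain ⟨p, q, hp0, hp1, hpq⟩ := exists_supporting_lines (c := Real.log 2) (x₀ := -Real.log 2)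
    hlc hmono hunb (by linarith) (by linarith)
  -- Index `0` is an added constant term `1`; the lines are shifted by one.
  set n : ℕ → ℕ := fun i => Nat.casesOn i 0 fun i => ⌈p i⌉₊ with hn
  set B : ℕ → ℝ := fun i => Nat.casesOn i 1 fun i => Real.exp (q i) with hB
  have hBpos : ∀ i, 0 < B i := by
    rintro (_ | i)
    · exact one_pos
    · exact Real.exp_pos _
  have hnmono : StrictMono n := by
    refine strictMono_nat_of_lt_succ ?_
    rintro (_ | i)
    · exact Nat.ceil_pos.2 (hp0 0)
    · change ⌈p i⌉₊ < ⌈p (i + 1)⌉₊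
      rw [Nat.lt_ceil]
      exact (Nat.ceil_lt_add_one (hp0 i).le).trans_le (hp1 i)
  have hhalf : (1 / 2 : ℝ) ∈ Ico (0 : ℝ) 1 := by norm_num
  have h00 : (0 : ℝ) ∈ Ico (0 : ℝ) 1 := by norm_num
  have hv0 := hv.pos 0 h00
  have hvh := hv.pos _ hhalf
  have hbig : ∀ r ∈ Ico (1 / 2 : ℝ) 1, (Summable fun i => B i * r ^ n i) ∧
      ∑' i, B i * r ^ n i ≤ (8 + (v 0)⁻¹) * v r ∧ ∃ i, 1 / 4 * v r ≤ B i * r ^ n i := by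
    intro r hr
    have hr0 : 0 < r := by linarith [hr.1]
    have hr' : r ∈ Ico (0 : ℝ) 1 := ⟨hr0.le, hr.2⟩
    have hvr := hv.pos r hr'
    set τ := Real.log r
    have hrτ : Real.exp τ = r := Real.exp_log hr0
    have hτ0 : τ < 0 := Real.log_neg hr0 hr.2
    have hτ2 : -Real.log 2 ≤ τ := by
      rw [← Real.log_inv]
      exact Real.log_le_log (by norm_num) (by linarith [hr.1])
    have hψτ : Real.exp (ψ τ) = v r := by simp only [hψ]; rw [hrτ, Real.exp_log hvr]
    have hterm : ∀ i, Real.exp (q i) * r ^ ⌈p i⌉₊ = Real.exp (q i + ⌈p i⌉₊ * τ) := fun i => by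
      rw [Real.exp_add, Real.exp_nat_mul, hrτ]
    have hup : ∀ i, Real.exp (q i) * r ^ ⌈p i⌉₊ ≤ Real.exp (q i + p i * τ) := fun i => by
      rw [hterm, Real.exp_le_exp]
      have := mul_le_mul_of_nonpos_right (Nat.le_ceil (p i)) hτ0.le
      linarith
    have hlow : ∀ i, 1 / 2 * Real.exp (q i + p i * τ) ≤ Real.exp (q i) * r ^ ⌈p i⌉₊ := fun i => by
      rw [hterm, one_div, ← Real.exp_log (two_pos : (0 : ℝ) < 2), ← Real.exp_neg, ← Real.exp_add,
        Real.exp_le_exp]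
      have := mul_le_mul_of_nonpos_right (Nat.ceil_lt_add_one (hp0 i).le).le hτ0.le
      linarith
    have hpow : ∀ k : ℕ, Real.exp (ψ τ - (k - 1) * Real.log 2) = 2 * v r * (1 / 2) ^ k := by
      intro k
      rw [show ψ τ - (k - 1) * Real.log 2 = ψ τ + Real.log 2 + k * (-Real.log 2) by ring,
        Real.exp_add, Real.exp_add, Real.exp_nat_mul, Real.exp_neg, Real.exp_log two_pos, hψτ]
      ring
    obtain ⟨j, h1, h2, h3⟩ := hpq τ ⟨hτ2, hτ0⟩
    obtain ⟨hs, ht⟩ := summable_and_tsum_le_of_two_sided_geometric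
      (f := fun i => Real.exp (q i) * r ^ ⌈p i⌉₊) (A := 2 * v r) (j := j)
      (fun i => by positivity)
      (fun k => (hup _).trans (by rw [← hpow]; exact Real.exp_le_exp.2 (h2 k)))
      (fun i k hik => (hup _).trans (by rw [← hpow]; exact Real.exp_le_exp.2 (h3 i k hik)))
    have hs' : Summable fun i => B i * r ^ n i := (summable_nat_add_iff 1).1 hs
    refine ⟨hs', ?_, j + 1, ?_⟩
    · rw [hs'.tsum_eq_zero_add]
      have e0 : B 0 * r ^ n 0 = 1 := by simp [hB, hn]
      have h4 : 1 ≤ (v 0)⁻¹ * v r := by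
        rw [le_inv_mul_iff₀ hv0, mul_one]
        exact hv.monotoneOn h00 hr' hr0.le
      rw [e0]
      have h5 : ∑' i, B (i + 1) * r ^ n (i + 1) ≤ 4 * (2 * v r) := ht
      linarith
    · have h4 := hlow j
      have h5 : 1 / 2 * v r ≤ Real.exp (q j + p j * τ) := by
        rw [← hψτ, one_div, ← Real.exp_log (two_pos : (0 : ℝ) < 2), ← Real.exp_neg, ← Real.exp_add,
          Real.exp_le_exp]
        linarith
      change 1 / 4 * v r ≤ Real.exp (q j) * r ^ ⌈p j⌉₊
      linarith
  have hKpos : 0 < 8 + (v 0)⁻¹ := by positivity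
  refine ⟨n, B, min (1 / 4) (v (1 / 2))⁻¹, max (8 + (v 0)⁻¹) ((8 + (v 0)⁻¹) * (v (1 / 2) / v 0)),
    hnmono, rfl, hBpos, lt_min (by norm_num) (by positivity), lt_max_of_lt_left hKpos,
    fun r hr => ?_⟩
  have hvr := hv.pos r hr
  by_cases hrh : 1 / 2 ≤ r
  · obtain ⟨h1, h2, i, hi⟩ := hbig r ⟨hrh, hr.2⟩
    refine ⟨h1, h2.trans ?_, i, le_trans ?_ hi⟩
    · gcongr; exact le_max_left _ _
    · gcongr; exact min_le_left _ _
  · obtain ⟨h1, h2, -⟩ := hbig (1 / 2) ⟨le_rfl, by norm_num⟩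
    have hle : ∀ i, B i * r ^ n i ≤ B i * (1 / 2) ^ n i := fun i => by
      have := hBpos i
      have := hr.1
      gcongr
      linarith
    have hs : Summable fun i => B i * r ^ n i :=
      h1.of_nonneg_of_le (fun i => mul_nonneg (hBpos i).le (pow_nonneg hr.1 _)) hle
    refine ⟨hs, (hs.tsum_le_tsum hle h1).trans (h2.trans ?_), 0, ?_⟩
    · have h3 : v 0 ≤ v r := hv.monotoneOn h00 hr hr.1
      calc (8 + (v 0)⁻¹) * v (1 / 2) = (8 + (v 0)⁻¹) * (v (1 / 2) / v 0) * v 0 := by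
            field_simp
        _ ≤ (8 + (v 0)⁻¹) * (v (1 / 2) / v 0) * v r := by gcongr
        _ ≤ _ := by gcongr; exact le_max_right _ _
    · have e0 : B 0 * r ^ n 0 = 1 := by simp [hB, hn]
      rw [e0]
      calc min (1 / 4) (v (1 / 2))⁻¹ * v r ≤ (v (1 / 2))⁻¹ * v r := by
            gcongr; exact min_le_right _ _
        _ ≤ 1 := by
            rw [inv_mul_le_iff₀ hvh, mul_one]
            exact hv.monotoneOn hr hhalf (by linarith)

end LacunarySeries

/-! ### Orthogonality of powers and prescribed square integrals. -/

section RotationInvariant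

open ComplexConjugate

variable {X : Type*} [TopologicalSpace X] [CompactSpace X] [MeasurableSpace X]
  [OpensMeasurableSpace X] {μ : Measure X} [IsFiniteMeasure μ] {P : X → ℂ}

/-- Rotating by the angle `π / (a - b)` changes the sign of the integrand. -/
theorem integral_pow_mul_conj_pow_eq_zero {X : Type*} [MeasurableSpace X] {μ : Measure X}
    {P : X → ℂ}
    (hinv : ∀ (θ : ℝ) (g : ℂ → ℂ), Continuous g →
      ∫ x, g (Complex.exp (θ * Complex.I) * P x) ∂μ = ∫ x, g (P x) ∂μ)
    {a b : ℕ} (hab : a ≠ b) : ∫ x, P x ^ a * conj (P x) ^ b ∂μ = 0 := by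
  have hab' : (a : ℂ) - b ≠ 0 := sub_ne_zero.2 (by exact_mod_cast hab)
  have h := hinv (Real.pi / (a - b)) (fun z => z ^ a * conj z ^ b) (by fun_prop)
  have hconst : ∀ z : ℂ, (Complex.exp ((Real.pi / (a - b) : ℝ) * Complex.I) * z) ^ a *
      conj (Complex.exp ((Real.pi / (a - b) : ℝ) * Complex.I) * z) ^ b =
      -(z ^ a * conj z ^ b) := by
    intro z
    rw [map_mul, ← Complex.exp_conj, map_mul, Complex.conj_ofReal, Complex.conj_I, mul_pow, mul_pow,
      ← Complex.exp_nat_mul, ← Complex.exp_nat_mul, mul_mul_mul_comm, ← Complex.exp_add,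
      show (a : ℂ) * ((Real.pi / (a - b) : ℝ) * Complex.I) +
        b * ((Real.pi / (a - b) : ℝ) * -Complex.I) = Real.pi * Complex.I by
          push_cast; field_simp; ring, Complex.exp_pi_mul_I]
    ring
  simp_rw [hconst] at h
  rw [integral_neg] at h
  exact self_eq_neg.1 h.symm

/-- The open set where `‖P‖ > ρ` has positive mass. Since `ρ < 1` is arbitrary, dividing
coefficients by roots of moments does not destroy convergence in the disc. -/
theorem exists_pos_mul_pow_le_moment [μ.IsOpenPosMeasure] (hP : Continuous P)
    (hP1 : ∃ x, ‖P x‖ = 1) {ρ : ℝ} (hρ0 : 0 ≤ ρ) (hρ : ρ < 1) :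
    ∃ κ > 0, ∀ n : ℕ, κ * (ρ ^ n) ^ 2 ≤ ∫ x, (‖P x‖ ^ n) ^ 2 ∂μ := by
  obtain ⟨x₀, hx₀⟩ := hP1
  set A : Set X := {x | ρ < ‖P x‖} with hA
  have hAo : IsOpen A := isOpen_lt continuous_const hP.norm
  have hApos : 0 < μ A := hAo.measure_pos μ ⟨x₀, by simpa [hA, hx₀] using hρ⟩
  refine ⟨μ.real A, ENNReal.toReal_pos hApos.ne' (measure_ne_top _ _), fun n => ?_⟩
  have hint : Integrable (fun x => (‖P x‖ ^ n) ^ 2) μ :=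
    (by fun_prop : Continuous _).integrable_of_compactSpace
  calc μ.real A * (ρ ^ n) ^ 2 = ∫ _ in A, (ρ ^ n) ^ 2 ∂μ := by simp
    _ ≤ ∫ x in A, (‖P x‖ ^ n) ^ 2 ∂μ := by
        refine setIntegral_mono_on (integrable_const _) hint.integrableOn hAo.measurableSet
          fun x hx => ?_
        have : ρ ≤ ‖P x‖ := le_of_lt hx
        gcongr
    _ ≤ ∫ x, (‖P x‖ ^ n) ^ 2 ∂μ :=
        setIntegral_le_integral hint (Filter.Eventually.of_forall fun x => by positivity)

theorem differentiableOn_tsum_pow {a : ℕ → ℝ} {n : ℕ → ℕ}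
    (ha : ∀ r ∈ Ico (0 : ℝ) 1, Summable fun i => |a i| * r ^ n i) :
    DifferentiableOn ℂ (fun z : ℂ => ∑' i, (a i : ℂ) * z ^ n i) (Metric.ball 0 1) := by
  intro z hz
  have hz' : ‖z‖ < 1 := by simpa using hz
  obtain ⟨R, hzR, hR⟩ := exists_between hz'
  have h := Complex.differentiableOn_tsum_of_summable_norm
    (F := fun i (z : ℂ) => (a i : ℂ) * z ^ n i)
    (ha R ⟨(norm_nonneg z).trans hzR.le, hR⟩) (fun i => by fun_prop)
    (Metric.isOpen_ball (x := (0 : ℂ)) (ε := R)) (fun i w hw => by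
      have hw' : ‖w‖ < R := by simpa using hw
      rw [norm_mul, norm_pow, Complex.norm_real, Real.norm_eq_abs]
      gcongr)
  exact (h.differentiableAt (Metric.isOpen_ball.mem_nhds (by simpa using hzR))).differentiableWithinAt

theorem integral_mul_tsum_pow (hP : Continuous P) (hP1 : ∀ x, ‖P x‖ ≤ 1) {c : ℕ → ℝ}
    {n : ℕ → ℕ} (hc : Summable fun i => |c i|) {G : X → ℂ} (hG : Continuous G) :
    ∫ x, G x * ∑' i, (c i : ℂ) * P x ^ n i ∂μ = ∑' i, (c i : ℂ) * ∫ x, G x * P x ^ n i ∂μ := by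
  obtain ⟨K, hK⟩ : ∃ K, ∀ x, ‖G x‖ ≤ K := by
    obtain ⟨K, hK⟩ := isCompact_univ.exists_bound_of_continuousOn hG.continuousOn
    exact ⟨K, fun x => hK x (mem_univ x)⟩
  have hterm : ∀ i x, ‖G x * ((c i : ℂ) * P x ^ n i)‖ ≤ K * |c i| := fun i x => by
    rw [norm_mul, norm_mul, norm_pow, Complex.norm_real, Real.norm_eq_abs]
    have h1 : |c i| * ‖P x‖ ^ n i ≤ |c i| :=
      mul_le_of_le_one_right (abs_nonneg _) (pow_le_one₀ (norm_nonneg _) (hP1 x))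
    exact mul_le_mul (hK x) h1 (by positivity) ((norm_nonneg _).trans (hK x))
  have hint : ∀ i, Integrable (fun x => G x * ((c i : ℂ) * P x ^ n i)) μ := fun i =>
    (by fun_prop : Continuous _).integrable_of_compactSpace
  have hsum : Summable fun i => ∫ x, ‖G x * ((c i : ℂ) * P x ^ n i)‖ ∂μ := by
    refine Summable.of_nonneg_of_le (fun i => integral_nonneg fun x => norm_nonneg _) (fun i => ?_)
      ((hc.mul_left K).mul_left (μ.real univ))
    calc _ ≤ ∫ _, K * |c i| ∂μ := integral_mono (hint i).norm (integrable_const _) (hterm i)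
      _ = _ := by simp
  have h := (hasSum_integral_of_summable_integral_norm hint hsum).tsum_eq
  simp_rw [← tsum_mul_left]
  rw [← h]
  refine tsum_congr fun i => ?_
  rw [← integral_const_mul]
  refine integral_congr_ae (Filter.Eventually.of_forall fun x => ?_)
  ring

/-- The coefficients are `B i` divided by the `L²` norm of `P ^ n i`, so orthogonality gives the
first formula. The second uses `(Re f)² = (|f|² + Re f²) / 2`: in `∫ f²` only the constant term
survives, as exponents `≥ 0` add to zero only if both vanish. -/
theorem exists_holomorphic_with_square_integral [μ.IsOpenPosMeasure] (hP : Continuous P)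
    (hP1 : ∀ x, ‖P x‖ ≤ 1) (hPmax : ∃ x, ‖P x‖ = 1)
    (hinv : ∀ (θ : ℝ) (g : ℂ → ℂ), Continuous g →
      ∫ x, g (Complex.exp (θ * Complex.I) * P x) ∂μ = ∫ x, g (P x) ∂μ)
    {n : ℕ → ℕ} {B : ℕ → ℝ} (hn : StrictMono n) (hn0 : n 0 = 0)
    (hB : ∀ r ∈ Ico (0 : ℝ) 1, Summable fun i => |B i| * r ^ n i) :
    ∃ F : ℂ → ℂ, DifferentiableOn ℂ F (Metric.ball 0 1) ∧ ∀ r ∈ Ico (0 : ℝ) 1,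
      ∫ x, ‖F (r * P x)‖ ^ 2 ∂μ = ∑' i, (B i * r ^ n i) ^ 2 ∧
      ∫ x, (F (r * P x)).re ^ 2 ∂μ = (∑' i, (B i * r ^ n i) ^ 2 + B 0 ^ 2) / 2 := by
  set M : ℕ → ℝ := fun k => ∫ x, (‖P x‖ ^ k) ^ 2 ∂μ with hM
  have hMpos : ∀ k, 0 < M k := fun k => by
    obtain ⟨κ, hκ, h⟩ := exists_pos_mul_pow_le_moment (μ := μ) hP hPmax (ρ := 1 / 2)
      (by norm_num) (by norm_num)
    exact lt_of_lt_of_le (by positivity) (h k)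
  set a : ℕ → ℝ := fun i => B i / √(M (n i)) with ha
  have hsuma : ∀ r ∈ Ico (0 : ℝ) 1, Summable fun i => |a i| * r ^ n i := by
    intro r hr
    have hs1 : √r < 1 := by
      rw [Real.sqrt_lt' one_pos]; simpa using hr.2
    -- Split `r ^ n` into two factors `√r ^ n`: one is absorbed by the moment bound, the other keeps
    -- the series for `B` convergent.
    obtain ⟨κ, hκ, h⟩ := exists_pos_mul_pow_le_moment (μ := μ) hP hPmax (Real.sqrt_nonneg r) hs1
    refine Summable.of_nonneg_of_le (fun i => by have := hr.1; positivity) (fun i => ?_)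
      ((hB √r ⟨Real.sqrt_nonneg r, hs1⟩).mul_left (√κ)⁻¹)
    have h1 : √κ * √r ^ n i ≤ √(M (n i)) := by
      refine Real.le_sqrt_of_sq_le ?_
      rw [mul_pow, Real.sq_sqrt hκ.le]
      exact h (n i)
    have hr2 : r ^ n i = √r ^ n i * √r ^ n i := by
      rw [← mul_pow, Real.mul_self_sqrt hr.1]
    have hMi : 0 < √(M (n i)) := Real.sqrt_pos.2 (hMpos _)
    simp only [ha]
    rw [abs_div, abs_of_pos hMi, hr2, div_mul_eq_mul_div, div_le_iff₀ hMi]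
    have hκ' : 0 < √κ := Real.sqrt_pos.2 hκ
    calc |B i| * (√r ^ n i * √r ^ n i) =
          (√κ)⁻¹ * (|B i| * √r ^ n i) * (√κ * √r ^ n i) := by field_simp
      _ ≤ _ := by gcongr
  refine ⟨fun z => ∑' i, (a i : ℂ) * z ^ n i, differentiableOn_tsum_pow hsuma, fun r hr => ?_⟩
  set c : ℕ → ℝ := fun i => a i * r ^ n i with hc
  have hcs : Summable fun i => |c i| := by
    refine (hsuma r hr).congr fun i => ?_
    rw [hc, abs_mul, abs_of_nonneg (pow_nonneg hr.1 _)]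
  set f : X → ℂ := fun x => ∑' i, (a i : ℂ) * (r * P x) ^ n i with hf
  have hfc : Continuous f := by
    refine (differentiableOn_tsum_pow hsuma).continuousOn.comp_continuous
      (f := fun x => (r : ℂ) * P x) (by fun_prop) fun x => ?_
    have : r * ‖P x‖ < 1 := (mul_le_of_le_one_right hr.1 (hP1 x)).trans_lt hr.2
    simpa [abs_of_nonneg hr.1] using this
  have hfsum : ∀ x, f x = ∑' i, (c i : ℂ) * P x ^ n i := fun x => tsum_congr fun i => by
    simp only [hc]; push_cast; rw [mul_pow]; ring
  have hmul : ∀ {G : X → ℂ}, Continuous G →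
      ∫ x, G x * f x ∂μ = ∑' i, (c i : ℂ) * ∫ x, G x * P x ^ n i ∂μ := fun hG => by
    simp_rw [hfsum]
    exact integral_mul_tsum_pow hP hP1 hcs hG
  have hMC : ∀ k, ∫ x, conj (P x) ^ k * P x ^ k ∂μ = M k := fun k => by
    rw [hM, ← integral_complex_ofReal]
    refine integral_congr_ae (Filter.Eventually.of_forall fun x => ?_)
    simp only
    rw [← mul_pow, mul_comm, Complex.mul_conj, Complex.normSq_eq_norm_sq]
    push_cast
    ring
  have hconj : ∀ k, ∫ x, conj (f x) * P x ^ n k ∂μ = c k * M (n k) := fun k => by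
    have h1 : ∫ x, conj (P x) ^ n k * f x ∂μ = c k * M (n k) := by
      rw [hmul (by fun_prop), tsum_eq_single k]
      · rw [hMC]
      · intro i hi
        have := integral_pow_mul_conj_pow_eq_zero hinv (hn.injective.ne hi)
        simp_rw [mul_comm (conj _ ^ _)]
        rw [this, mul_zero]
    have h2 := congrArg conj h1
    rw [← integral_conj] at h2
    simpa [mul_comm] using h2
  have hsq : ∀ k, ∫ x, f x * P x ^ n k ∂μ = if k = 0 then (c 0 * M 0 : ℂ) else 0 := fun k => by
    have h1 : ∀ i, ∫ x, P x ^ n k * P x ^ n i ∂μ = if n k + n i = 0 then (M 0 : ℂ) else 0 := by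
      intro i
      split_ifs with h
      · have h3 : n k = 0 := by omega
        have h4 : n i = 0 := by omega
        simp [h3, h4, hM]
      · have := integral_pow_mul_conj_pow_eq_zero hinv h
        simpa [pow_add] using this
    simp_rw [mul_comm (f _)]
    rw [hmul (by fun_prop)]
    simp_rw [h1]
    split_ifs with hk
    · rw [tsum_eq_single 0, if_pos (by rw [hk, hn0])]
      intro i hi
      rw [if_neg, mul_zero]
      have := hn (Nat.pos_of_ne_zero hi)
      omega
    · have := hn (Nat.pos_of_ne_zero hk)
      rw [tsum_eq_single 0, if_neg (by omega), mul_zero]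
      intro i _
      rw [if_neg (by omega), mul_zero]
  have hcM : ∀ k, c k ^ 2 * M (n k) = (B k * r ^ n k) ^ 2 := fun k => by
    simp only [hc, ha]
    have h1 := Real.sq_sqrt (hMpos (n k)).le
    have h2 : √(M (n k)) ≠ 0 := (Real.sqrt_pos.2 (hMpos _)).ne'
    rw [← h1]
    simp only [Real.sqrt_sq (Real.sqrt_nonneg _)]
    field_simp
  have hI1 : ∫ x, conj (f x) * f x ∂μ = ((∑' i, (B i * r ^ n i) ^ 2 : ℝ) : ℂ) := by
    rw [hmul (by fun_prop), Complex.ofReal_tsum]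
    refine tsum_congr fun k => ?_
    rw [hconj, ← hcM k]
    push_cast
    ring
  have hI2 : ∫ x, f x * f x ∂μ = ((B 0 ^ 2 : ℝ) : ℂ) := by
    rw [hmul hfc, tsum_eq_single 0]
    · have := hcM 0
      rw [hn0, pow_zero, mul_one] at this
      rw [hsq, if_pos rfl, ← this]
      push_cast
      ring
    · intro k hk
      rw [hsq, if_neg hk, mul_zero]
  have hN : ∫ x, ‖f x‖ ^ 2 ∂μ = ∑' i, (B i * r ^ n i) ^ 2 := by
    rw [← Complex.ofReal_inj, ← hI1, ← integral_complex_ofReal]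
    refine integral_congr_ae (Filter.Eventually.of_forall fun x => ?_)
    simp only
    rw [mul_comm, Complex.mul_conj, Complex.normSq_eq_norm_sq]
  refine ⟨hN, ?_⟩
  have hff : Integrable (fun x => f x * f x) μ :=
    (hfc.mul hfc).integrable_of_compactSpace
  have hre : ∫ x, (f x * f x).re ∂μ = B 0 ^ 2 := by
    have h1 : ∫ x, Complex.reCLM (f x * f x) ∂μ = Complex.reCLM (∫ x, f x * f x ∂μ) :=
      Complex.reCLM.integral_comp_comm hff
    rw [hI2] at h1
    simpa only [Complex.reCLM_apply, Complex.ofReal_re] using h1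
  have hpt : ∀ x, (f x).re ^ 2 = (‖f x‖ ^ 2 + (f x * f x).re) / 2 := fun x => by
    rw [← Complex.normSq_eq_norm_sq, Complex.normSq_apply, Complex.mul_re]
    ring
  change ∫ x, (f x).re ^ 2 ∂μ = _
  simp_rw [hpt]
  have hi1 : Integrable (fun x => ‖f x‖ ^ 2) μ := (hfc.norm.pow 2).integrable_of_compactSpace
  have hi2 : Integrable (fun x => (f x * f x).re) μ := hff.re
  rw [integral_div, integral_add hi1 hi2, hN, hre]

end RotationInvariant

/-! ### Equivalence of weights and pullback of disc functions. -/

theorem equivOnUnitInterval_of_sq_le {u v : ℝ → ℝ} (hu : ∀ r, 0 ≤ u r)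
    (hv : ∀ r ∈ Ico (0 : ℝ) 1, 0 ≤ v r) {α β : ℝ} (hα : 0 < α) (hβ : 0 < β)
    (h : ∀ r ∈ Ico (0 : ℝ) 1, α * v r ^ 2 ≤ u r ^ 2 ∧ u r ^ 2 ≤ β * v r ^ 2) :
    EquivOnUnitInterval u v := by
  refine ⟨(√β)⁻¹, (√α)⁻¹, by positivity, by positivity, fun r hr => ?_⟩
  obtain ⟨h1, h2⟩ := h r hr
  constructor
  · rw [inv_mul_le_iff₀ (by positivity)]
    refine (abs_le_of_sq_le_sq' ?_ (mul_nonneg (by positivity) (hv r hr))).2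
    rwa [mul_pow, Real.sq_sqrt hβ.le]
  · rw [le_inv_mul_iff₀ (by positivity)]
    refine (abs_le_of_sq_le_sq' ?_ (hu r)).2
    rwa [mul_pow, Real.sq_sqrt hα.le]

theorem EquivOnUnitInterval.trans_symm {u v w : ℝ → ℝ} (h : EquivOnUnitInterval u v)
    (h' : EquivOnUnitInterval w v) : EquivOnUnitInterval u w := by
  obtain ⟨a, b, ha, hb, h⟩ := h
  obtain ⟨c, d, hc, hd, h'⟩ := h'
  refine ⟨a / d, b / c, by positivity, by positivity, fun r hr => ?_⟩
  obtain ⟨h1, h2⟩ := h r hr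
  obtain ⟨h3, h4⟩ := h' r hr
  constructor
  · rw [div_mul_eq_mul_div, div_le_iff₀ hd]
    linarith
  · rw [div_mul_eq_mul_div, le_div_iff₀ hc]
    linarith

theorem EquivOnUnitInterval.sq {u v : ℝ → ℝ} (h : EquivOnUnitInterval u v) (hu : ∀ r, 0 ≤ u r) :
    EquivOnUnitInterval (fun r => u r ^ 2) fun r => v r ^ 2 := by
  obtain ⟨a, b, ha, hb, h⟩ := h
  refine ⟨a ^ 2, b ^ 2, by positivity, by positivity, fun r hr => ?_⟩
  obtain ⟨h1, h2⟩ := h r hr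
  have h3 : 0 ≤ a * u r := mul_nonneg ha.le (hu r)
  rw [← mul_pow, ← mul_pow]
  exact ⟨pow_le_pow_left₀ h3 h1 2, pow_le_pow_left₀ (h3.trans h1) h2 2⟩

theorem summable_sq_and_tsum_sq_le {x : ℕ → ℝ} (hx : ∀ i, 0 ≤ x i) (hs : Summable x) :
    (Summable fun i => x i ^ 2) ∧ ∑' i, x i ^ 2 ≤ (∑' i, x i) ^ 2 := by
  have hle : ∀ i, x i ^ 2 ≤ (∑' i, x i) * x i := fun i => by
    rw [_root_.sq]
    exact mul_le_mul_of_nonneg_right (hs.le_tsum i fun j _ => hx j) (hx i)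
  have hs2 : Summable fun i => x i ^ 2 :=
    (hs.mul_left _).of_nonneg_of_le (fun i => sq_nonneg _) hle
  refine ⟨hs2, (hs2.tsum_le_tsum hle (hs.mul_left _)).trans ?_⟩
  rw [tsum_mul_left, _root_.sq]

/-- The sum of squares lies between the square of its largest term and the square of the sum, both
comparable to `v²`. Through `hrot`, isometry invariance of the sphere becomes the rotation
invariance required of `π`. -/
theorem exists_disc_function_L2Mean_equiv {E : Type*} [NormedAddCommGroup E]
    [InnerProductSpace ℝ E] [FiniteDimensional ℝ E] [MeasurableSpace E] [BorelSpace E]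
    (π : E →L[ℝ] ℂ) (hπ : ∀ x, ‖π x‖ ≤ ‖x‖) (hmax : ∃ y, ‖y‖ = 1 ∧ ‖π y‖ = 1)
    (hrot : ∀ θ : ℝ, ∃ U : E ≃ₗᵢ[ℝ] E, ∀ x, π (U x) = Complex.exp (θ * Complex.I) * π x)
    {v : ℝ → ℝ} (hv : IsWeightFunction v) (hlc : IsLogConvex v) :
    ∃ F : ℂ → ℂ, DifferentiableOn ℂ F (Metric.ball 0 1) ∧
      EquivOnUnitInterval (L2Mean fun x => F (π x)) v ∧
      EquivOnUnitInterval (L2Mean fun x => (F (π x)).re) v := by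
  obtain ⟨n, B, c, C, hn, hn0, hB, hc, hC, h⟩ := exists_lacunary_series hv hlc
  obtain ⟨y₀, hy₀, hπy₀⟩ := hmax
  have : Nontrivial E := ⟨y₀, 0, fun h => by simp [h] at hy₀⟩
  obtain ⟨F, hF, hFint⟩ := exists_holomorphic_with_square_integral
    (μ := (volume : Measure E).toSphere) (P := fun y : Metric.sphere (0 : E) 1 => π y)
    (by fun_prop) (fun y => (hπ y).trans (by simp)) ⟨⟨y₀, by simpa using hy₀⟩, hπy₀⟩
    (fun θ g hg => by
      obtain ⟨U, hU⟩ := hrot θ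
      have := integral_sphere_comp_isometry U (g := fun x => g (π x)) (by fun_prop)
      simpa only [hU] using this) hn hn0
    (fun r hr => (h r hr).1.congr fun i => by rw [abs_of_pos (hB i)])
  set V : ℝ := (volume : Measure E).toSphere.real univ
  have hV : 0 < V := ENNReal.toReal_pos
    (Measure.measure_univ_ne_zero.2 (Measure.toSphere_ne_zero _)) (measure_ne_top _ _)
  have hsm : ∀ (r : ℝ) (x : E), π (r • x) = r * π x := fun r x => by simp
  have hbd : ∀ r ∈ Ico (0 : ℝ) 1, (c * v r) ^ 2 ≤ ∑' i, (B i * r ^ n i) ^ 2 ∧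
      ∑' i, (B i * r ^ n i) ^ 2 ≤ (C * v r) ^ 2 ∧ B 0 ^ 2 ≤ ∑' i, (B i * r ^ n i) ^ 2 := by
    intro r hr
    obtain ⟨hs, hle, i, hi⟩ := h r hr
    have hnn : ∀ i, 0 ≤ B i * r ^ n i := fun i => mul_nonneg (hB i).le (pow_nonneg hr.1 _)
    obtain ⟨hs2, hle2⟩ := summable_sq_and_tsum_sq_le hnn hs
    have hvr := hv.pos r hr
    refine ⟨?_, hle2.trans (pow_le_pow_left₀ (tsum_nonneg hnn) hle 2), ?_⟩
    · exact (pow_le_pow_left₀ (by positivity) hi 2).trans (hs2.le_tsum i fun j _ => sq_nonneg _)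
    · have := hs2.le_tsum 0 fun j _ => sq_nonneg _
      simpa [hn0] using this
  refine ⟨F, hF, ?_, ?_⟩
  · refine equivOnUnitInterval_of_sq_le (L2Mean_nonneg _) (fun r hr => (hv.pos r hr).le)
      (α := V⁻¹ * c ^ 2) (β := V⁻¹ * C ^ 2) (by positivity) (by positivity) fun r hr => ?_
    obtain ⟨h1, h2, -⟩ := hbd r hr
    rw [L2Mean_sq]
    simp only [hsm]
    rw [(hFint r hr).1, mul_assoc, mul_assoc, ← mul_pow, ← mul_pow]
    constructor <;> gcongr
  -- Since `B 0 ^ 2` is itself one of the terms, passing to the real part costs at most a factor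
  -- `2`.
  · refine equivOnUnitInterval_of_sq_le (L2Mean_nonneg _) (fun r hr => (hv.pos r hr).le)
      (α := V⁻¹ * (c ^ 2 / 2)) (β := V⁻¹ * C ^ 2) (by positivity) (by positivity) fun r hr => ?_
    obtain ⟨h1, h2, h3⟩ := hbd r hr
    rw [L2Mean_sq]
    simp only [hsm, Real.norm_eq_abs, sq_abs]
    rw [(hFint r hr).2, mul_assoc, mul_assoc, div_mul_eq_mul_div, ← mul_pow, ← mul_pow]
    constructor
    · gcongr
      linarith [sq_nonneg (B 0)]
    · gcongr
      linarith

/-! ### Harmonic functions depending on two coordinates. -/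

section Harmonic

variable {k : ℕ}

/-- The projection of `ℝ^(k+2)` to the plane of its first two coordinates, identified with `ℂ`. -/
noncomputable def planeProj (k : ℕ) : EuclideanSpace ℝ (Fin (k + 2)) →L[ℝ] ℂ :=
  (EuclideanSpace.proj (0 : Fin (k + 2))).smulRight (1 : ℂ) +
    (EuclideanSpace.proj (1 : Fin (k + 2))).smulRight Complex.I

theorem planeProj_apply (x : EuclideanSpace ℝ (Fin (k + 2))) :
    planeProj k x = x 0 + x 1 * Complex.I := by
  simp [planeProj]

theorem norm_planeProj_le (x : EuclideanSpace ℝ (Fin (k + 2))) : ‖planeProj k x‖ ≤ ‖x‖ := by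
  refine (abs_le_of_sq_le_sq' ?_ (norm_nonneg _)).2
  rw [planeProj_apply, EuclideanSpace.norm_sq_eq, Fin.sum_univ_succ, Fin.sum_univ_succ,
    ← Complex.normSq_eq_norm_sq, Complex.normSq_add_mul_I]
  have : 0 ≤ ∑ i : Fin k, ‖x i.succ.succ‖ ^ 2 := by positivity
  simp only [Real.norm_eq_abs, sq_abs, Fin.succ_zero_eq_one] at *
  linarith

/-- Rotation by `θ` in the plane of the first two coordinates of `ℝ^(k+2)`. -/
noncomputable def planeRotation (k : ℕ) (θ : ℝ) :
    EuclideanSpace ℝ (Fin (k + 2)) ≃ₗᵢ[ℝ] EuclideanSpace ℝ (Fin (k + 2)) :=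
  LinearIsometry.toLinearIsometryEquiv
    { toFun := fun x => WithLp.toLp 2 (Fin.cons (Real.cos θ * x 0 - Real.sin θ * x 1)
        (Fin.cons (Real.sin θ * x 0 + Real.cos θ * x 1) fun i : Fin k => x i.succ.succ))
      map_add' := fun x y => by
        ext i
        refine Fin.cases ?_ (fun i => Fin.cases ?_ (fun i => ?_) i) i <;> simp <;> ring
      map_smul' := fun c x => by
        ext i
        refine Fin.cases ?_ (fun i => Fin.cases ?_ (fun i => ?_) i) i <;> simp <;> ring
      norm_map' := fun x => by
        refine (sq_eq_sq₀ (norm_nonneg _) (norm_nonneg _)).1 ?_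
        rw [EuclideanSpace.norm_sq_eq, EuclideanSpace.norm_sq_eq]
        simp only [Fin.sum_univ_succ, Real.norm_eq_abs, sq_abs]
        simp
        nlinarith [Real.sin_sq_add_cos_sq θ] } rfl

theorem planeProj_planeRotation (θ : ℝ) (x : EuclideanSpace ℝ (Fin (k + 2))) :
    planeProj k (planeRotation k θ x) = Complex.exp (θ * Complex.I) * planeProj k x := by
  have h0 : planeRotation k θ x 0 = Real.cos θ * x 0 - Real.sin θ * x 1 := rfl
  have h1 : planeRotation k θ x 1 = Real.sin θ * x 0 + Real.cos θ * x 1 := rfl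
  rw [planeProj_apply, planeProj_apply, h0, h1, Complex.exp_mul_I, ← Complex.ofReal_cos,
    ← Complex.ofReal_sin]
  push_cast
  linear_combination (-(Complex.sin θ * x 1)) * Complex.I_sq

/-- The projection sends the standard basis to `1`, `I` and zeros, so the Laplacian of the pullback
is the planar one. -/
theorem isHarmonicOnBall_re_comp_planeProj {F : ℂ → ℂ}
    (hF : DifferentiableOn ℂ F (Metric.ball 0 1)) :
    IsHarmonicOnBall (k + 2) fun x => (F (planeProj k x)).re := by
  have hmem : ∀ x ∈ Metric.ball (0 : EuclideanSpace ℝ (Fin (k + 2))) 1,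
      planeProj k x ∈ Metric.ball (0 : ℂ) 1 := fun x hx => by
    rw [mem_ball_zero_iff] at *
    exact (norm_planeProj_le x).trans_lt hx
  have hharm : ∀ x ∈ Metric.ball (0 : EuclideanSpace ℝ (Fin (k + 2))) 1,
      InnerProductSpace.HarmonicAt (fun z => (F z).re) (planeProj k x) := fun x hx =>
    (hF.analyticAt (Metric.isOpen_ball.mem_nhds (hmem x hx))).harmonicAt_re
  intro x hx
  refine ⟨(hharm x hx).1.comp x (planeProj k).contDiff.contDiffAt, ?_⟩
  filter_upwards [Metric.isOpen_ball.mem_nhds hx] with z hz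
  rw [laplacian_comp_clm (EuclideanSpace.basisFun (Fin (k + 2)) ℝ) (f := fun z => (F z).re)
    (planeProj k) (hharm z hz).1]
  have h0 := (hharm z hz).2.self_of_nhds
  rw [InnerProductSpace.laplacian_eq_iteratedFDeriv_complexPlane] at h0
  rw [Fin.sum_univ_succ, Fin.sum_univ_succ]
  simp only [iteratedFDeriv_two_apply] at h0 ⊢
  have e0 : planeProj k (EuclideanSpace.basisFun (Fin (k + 2)) ℝ 0) = 1 := by
    simp [planeProj_apply]
  have e1 : planeProj k (EuclideanSpace.basisFun (Fin (k + 2)) ℝ (Fin.succ 0)) = Complex.I := by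
    simp [planeProj_apply]
  have e2 : ∀ i : Fin k,
      planeProj k (EuclideanSpace.basisFun (Fin (k + 2)) ℝ i.succ.succ) = 0 := fun i => by
    have h1 : (1 : Fin (k + 2)) ≠ i.succ.succ := by
      rw [← Fin.succ_zero_eq_one]; exact fun h => Fin.succ_ne_zero i (Fin.succ_injective _ h).symm
    simp [planeProj_apply, h1, (Fin.succ_ne_zero _).symm]
  simp only [e0, e1, e2]
  simpa using h0

end Harmonic

/-! ### The equivalences. -/

theorem proposition1 (d m : ℕ) (hd : 2 ≤ d) (hm : 1 ≤ m) (w : ℝ → ℝ) (hw : IsWeightFunction w) :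
    List.TFAE [
      ∃ v : ℝ → ℝ, IsWeightFunction v ∧ IsLogConvex v ∧ EquivOnUnitInterval w v,
      IsHarmonicallyL2Approximable d w,
      ∃ f : EuclideanSpace ℝ (Fin d) → ℝ,
        IsHarmonicOnBall d f ∧ EquivOnUnitInterval (L2Mean f) w,
      IsHolomorphicallyL2Approximable m w,
      ∃ f : EuclideanSpace ℂ (Fin m) → ℂ,
        IsHolomorphicOnBall m f ∧ EquivOnUnitInterval (L2Mean f) w] := by
  tfae_have 3 → 2 := fun ⟨f, hf, h⟩ =>
    ⟨1, fun _ => f, fun _ => hf, by simpa using h.sq (L2Mean_nonneg f)⟩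
  tfae_have 5 → 4 := fun ⟨f, hf, h⟩ =>
    ⟨1, fun _ => f, fun _ => hf, by simpa using h.sq (L2Mean_nonneg f)⟩
  tfae_have 1 → 3 := by
    rintro ⟨v, hv, hlc, hwv⟩
    obtain ⟨k, rfl⟩ := Nat.exists_eq_add_of_le' hd
    obtain ⟨F, hF, -, hFv⟩ := exists_disc_function_L2Mean_equiv (planeProj k) norm_planeProj_le
      ⟨EuclideanSpace.single 0 1, by simp, by simp [planeProj_apply]⟩
      (fun θ => ⟨planeRotation k θ, planeProj_planeRotation θ⟩) hv hlc
    exact ⟨_, isHarmonicOnBall_re_comp_planeProj hF, hFv.trans_symm hwv⟩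
  tfae_have 1 → 5 := by
    rintro ⟨v, hv, hlc, hwv⟩
    obtain ⟨k, rfl⟩ := Nat.exists_eq_add_of_le' hm
    set π : EuclideanSpace ℂ (Fin (k + 1)) →L[ℂ] ℂ := EuclideanSpace.proj 0
    have hπ : ∀ z, ‖π z‖ ≤ ‖z‖ := fun z => PiLp.norm_apply_le z 0
    obtain ⟨F, hF, hFv, -⟩ := exists_disc_function_L2Mean_equiv (π.restrictScalars ℝ) hπ
      ⟨EuclideanSpace.single 0 1, by simp, by simp [π]⟩
      (fun θ => ⟨phaseRotation (k + 1) θ, fun x => by simp [phaseRotation_apply]⟩) hv hlc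
    refine ⟨_, ?_, hFv.trans_symm hwv⟩
    refine hF.comp π.differentiable.differentiableOn fun z hz => ?_
    rw [mem_ball_zero_iff] at *
    exact (hπ z).trans_lt hz
  tfae_have 2 → 1 := by
    rintro ⟨J, f, hf, h⟩
    have : Nontrivial (EuclideanSpace ℝ (Fin d)) := by
      have : Nonempty (Fin d) := ⟨⟨0, by omega⟩⟩
      infer_instance
    refine exists_logConvex_weight_of_integral_inner hw (fun j => (hf j).continuousOn)
      (fun j s hs u hu => ?_) h
    simpa [mul_comm] using integral_sphere_mul_of_harmonic (hf j) hs hu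
  tfae_have 4 → 1 := fun ⟨J, f, hf, h⟩ =>
    exists_logConvex_weight_of_integral_inner hw (fun j => (hf j).continuousOn)
      (fun j s hs u hu => integral_sphere_inner_of_holomorphic (hf j) hs hu) h
  tfae_finish
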